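/- All logarithms are base $2$. For a finite graph $G=(V,E)$ and nonempty $A,B\subseteq V$, let $d(A,B)=\frac{e(A,B)}{|A||B|}$, where $e(A,B)$ is the number of pairs $(a,b)\in A\times B$ with $a$ adjacent to $b$. The graph $G$ is $(p,\lambda)$-pseudo-random if $|d(A,B)-p|\le \frac{\lambda}{\sqrt{|A||B|}}$ for all nonempty (not necessarily disjoint) $A,B\subseteq V$. A graph is $d$-degenerate if every nonempty subgraph of it has a vertex of degree at most $d$ in that subgraph. Theorem 4.5. Let $\chi\ge 2$, $d\ge 1$ and $k\ge 1$ be integers, and let $G$ be a $(p,\lambda)$-pseudo-random graph on $n\ge 1$ vertices with $0<p\le 3/4$ and $$\lambda\le\left(\left(\frac{p}{10k}\right)^{d}2^{-pk}\right)^{20\log\chi}n.$$ Then in every colouring of the edges of $G$ with two colours, every $d$-degenerate graph $H$ on $k$ vertices with chromatic number at most $\chi$ occurs as an induced monochromatic copy, that is, $G$ has an induced subgraph isomorphic to $H$ all of whose edges have the same colour. Moreover, for each such colouring of $G$, all of these induced monochromatic copies can be found in the same colour: there is one colour $c$ such that every such $H$ has an induced copy in $G$ all of whose edges have colour $c$.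 -/

import Mathlib

/-- `G` is `(p, lam)`-pseudo-random: `|d(A, B) - p| ≤ lam / √(|A| |B|)` for all nonempty vertex
sets `A`, `B` (not necessarily disjoint). Here `d(A, B) = e(A, B) / (|A| |B|)`, where `e(A, B)` is
the number of ordered pairs `(a, b) ∈ A × B` with `a`, `b` adjacent. -/
def IsPseudoRandom {V : Type*} (G : SimpleGraph V) [DecidableRel G.Adj] (p lam : ℝ) : Prop :=
  ∀ A B : Finset V, A.Nonempty → B.Nonempty →
    |(G.edgeDensity A B : ℝ) - p| ≤ lam / Real.sqrt ((A.card : ℝ) * (B.card : ℝ))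

/-- `H` is `d`-degenerate: every (nonempty) subgraph of `H` has a vertex of degree at most `d`. -/
def IsDegenerate {W : Type*} (H : SimpleGraph W) (d : ℕ) : Prop :=
  ∀ S : H.Subgraph, S.verts.Nonempty → ∃ v ∈ S.verts, (S.neighborSet v).encard ≤ d

/-- Under the edge colouring `C` of `G`, there is an induced copy of `H` in `G`
all of whose edges have colour `c`. -/
def HasInducedMonoCopy {V W K : Type*} {G : SimpleGraph V} (C : G.EdgeLabeling K)
    (c : K) (H : SimpleGraph W) : Prop :=
  ∃ f : H ↪g G, ∀ (i j : W) (h : H.Adj i j), C.get (f i) (f j) (f.map_rel_iff.mpr h) = c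

/-! Suppose colour 0 misses some `H₀` and colour 1 misses some `H₁`; let `R` be the relation of
colour 0. Pseudo-randomness says nothing about the colours, but it controls adjacency (density `p`)
and non-adjacency (density `1 - p`) between all large sets.

Order `H₀` so that every vertex has at most `d` earlier neighbours, and embed it greedily with edges
in `R`. Non-edges cause no trouble, so failure must come from `R`: every large set contains two
large subsets between which `R` is sparse (`exists_sparse_pair`). Iterating about `log χ` times
gives at least as many large sets as `H₁` needs colours, pairwise sparse in `R`
(`exists_sparse_family`).

Now embed `H₁` with its colour classes in different sets, asking only that edges go to edges of `G`.
A potential bounding the expected number of edges that land in `R` starts at no more than 1/4, and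
by averaging each vertex can be chosen so that it hardly grows (`exists_embedding_avoiding`). It
ends below 1, when it counts the edges in `R`; so there are none, and the copy of `H₁` has colour 1,
a contradiction. -/

/-! ### Counting pairs under the mixing property. -/

section PseudoRandom
open Finset
open scoped Classical

variable {V : Type*}

/-- The number of pairs `(x, y) ∈ A × B` with `r x y`, as a real number. -/
noncomputable def pairCount (r : V → V → Prop) (A B : Finset V) : ℝ :=
  ∑ x ∈ A, ∑ y ∈ B, if r x y then (1 : ℝ) else 0

/-- The proportion of pairs `(x, y) ∈ A × B` with `r x y`. -/
noncomputable def relDensity (r : V → V → Prop) (A B : Finset V) : ℝ :=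
  pairCount r A B / ((#A : ℝ) * #B)

/-- The expander mixing property of a relation `r` with density `p` and error `M`. -/
def Mixing (r : V → V → Prop) (p M : ℝ) : Prop :=
  ∀ A B : Finset V, |pairCount r A B - p * (#A * #B)| ≤ M * √((#A : ℝ) * #B)

lemma pairCount_eq_sum_card (r : V → V → Prop) (A B : Finset V) :
    pairCount r A B = ∑ x ∈ A, (#{y ∈ B | r x y} : ℝ) := by
  simp [pairCount]

lemma pairCount_comm {r : V → V → Prop} (hr : ∀ x y, r x y → r y x) (A B : Finset V) :
    pairCount r A B = pairCount r B A := by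
  unfold pairCount
  rw [sum_comm]
  have : ∀ x y, r x y ↔ r y x := fun x y => ⟨hr x y, hr y x⟩
  refine sum_congr rfl fun y _ => sum_congr rfl fun x _ => ?_
  simp only [this x y]

lemma pairCount_nonneg (r : V → V → Prop) (A B : Finset V) : 0 ≤ pairCount r A B :=
  sum_nonneg fun _ _ => sum_nonneg fun _ _ => by split_ifs <;> norm_num

lemma relDensity_nonneg (r : V → V → Prop) (A B : Finset V) : 0 ≤ relDensity r A B :=
  div_nonneg (pairCount_nonneg r A B) (by positivity)

lemma relDensity_comm {r : V → V → Prop} (hr : ∀ x y, r x y → r y x) (A B : Finset V) :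
    relDensity r A B = relDensity r B A := by
  unfold relDensity
  rw [pairCount_comm hr, mul_comm (#A : ℝ)]

/-- Few vertices of `A` have much fewer neighbours in `B` than expected. -/
lemma Mixing.card_low_degree_le {r : V → V → Prop} {p M : ℝ} (h : Mixing r p M) (hM : 0 ≤ M)
    (hp : 0 < p) {θ s : ℝ} (hθ : 0 < θ) (hs : 0 < s) (A B : Finset V) (hB : s ≤ #B) :
    (#{x ∈ A | (#{y ∈ B | r x y} : ℝ) < p * (1 - θ) * #B} : ℝ) ≤ M ^ 2 / (θ ^ 2 * p ^ 2 * s) := by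
  set X := {x ∈ A | (#{y ∈ B | r x y} : ℝ) < p * (1 - θ) * #B} with hX
  have h1 : pairCount r X B ≤ p * (1 - θ) * #B * #X := by
    rw [pairCount_eq_sum_card]
    calc ∑ x ∈ X, (#{y ∈ B | r x y} : ℝ) ≤ ∑ x ∈ X, p * (1 - θ) * #B :=
          sum_le_sum fun x hx => (mem_filter.mp hx).2.le
      _ = _ := by rw [sum_const, nsmul_eq_mul]; ring
  have h2 := (abs_le.mp (h X B)).1
  set z := √((#X : ℝ) * #B) with hz
  have hz0 : 0 ≤ z := Real.sqrt_nonneg _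
  have hzz : z * z = (#X : ℝ) * #B := Real.mul_self_sqrt (by positivity)
  -- The deficit of `X` against `B` is at least `θ p |X| |B|`, and mixing allows at most `M z`.
  have h3 : θ * p * (z * z) ≤ M * z := by rw [hzz]; linarith
  have h4 : θ * p * z ≤ M := by
    rcases hz0.eq_or_lt with h0 | h0
    · rw [← h0]; simpa using hM
    · exact le_of_mul_le_mul_right (by linarith) h0
  have h5 : (θ * p * z) ^ 2 ≤ M ^ 2 := pow_le_pow_left₀ (by positivity) h4 2
  have h6 : (#X : ℝ) * s ≤ z * z := by
    rw [hzz]; exact mul_le_mul_of_nonneg_left hB (by positivity)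
  rw [le_div_iff₀ (by positivity)]
  calc (#X : ℝ) * (θ ^ 2 * p ^ 2 * s) = θ ^ 2 * p ^ 2 * (#X * s) := by ring
    _ ≤ θ ^ 2 * p ^ 2 * (z * z) := by gcongr
    _ = (θ * p * z) ^ 2 := by ring
    _ ≤ _ := h5

/-- Most vertices of `A` have about as many neighbours in each `B j` as expected. -/
lemma exists_typical_subset {ι : Type*} (J : Finset ι) (r : ι → V → V → Prop) (pp : ι → ℝ)
    {p M θ s : ℝ} (hmix : ∀ j ∈ J, Mixing (r j) (pp j) M) (hM : 0 ≤ M) (hp : 0 < p)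
    (hpp : ∀ j ∈ J, p ≤ pp j) (hθ : 0 < θ) (hs : 0 < s) (A : Finset V) (B : ι → Finset V)
    (hB : ∀ j ∈ J, s ≤ #(B j)) (hA : #J * (M ^ 2 / (θ ^ 2 * p ^ 2 * s)) ≤ θ * #A) :
    ∃ T ⊆ A, (1 - θ) * #A ≤ #T ∧
      ∀ x ∈ T, ∀ j ∈ J, pp j * (1 - θ) * #(B j) ≤ #{y ∈ B j | r j x y} := by
  refine ⟨{x ∈ A | ∀ j ∈ J, pp j * (1 - θ) * #(B j) ≤ #{y ∈ B j | r j x y}},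
    filter_subset _ _, ?_, fun x hx => (mem_filter.mp hx).2⟩
  have h1 := card_filter_add_card_filter_not (s := A)
    (fun x => ∀ j ∈ J, pp j * (1 - θ) * #(B j) ≤ #{y ∈ B j | r j x y})
  have h2 : {x ∈ A | ¬ ∀ j ∈ J, pp j * (1 - θ) * #(B j) ≤ #{y ∈ B j | r j x y}} ⊆
      J.biUnion fun j => {x ∈ A | (#{y ∈ B j | r j x y} : ℝ) < pp j * (1 - θ) * #(B j)} := by
    intro x hx
    obtain ⟨hxA, hx⟩ := mem_filter.mp hx
    push Not at hx
    obtain ⟨j, hj, hlt⟩ := hx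
    exact mem_biUnion.mpr ⟨j, hj, mem_filter.mpr ⟨hxA, hlt⟩⟩
  have h3 : (#{x ∈ A | ¬ ∀ j ∈ J, pp j * (1 - θ) * #(B j) ≤ #{y ∈ B j | r j x y}} : ℝ) ≤
      ∑ j ∈ J, (#{x ∈ A | (#{y ∈ B j | r j x y} : ℝ) < pp j * (1 - θ) * #(B j)} : ℝ) := by
    exact_mod_cast (card_le_card h2).trans card_biUnion_le
  have h4 : ∑ j ∈ J, (#{x ∈ A | (#{y ∈ B j | r j x y} : ℝ) < pp j * (1 - θ) * #(B j)} : ℝ) ≤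
      ∑ j ∈ J, M ^ 2 / (θ ^ 2 * p ^ 2 * s) := by
    refine sum_le_sum fun j hj => ?_
    refine ((hmix j hj).card_low_degree_le hM (hp.trans_le (hpp j hj)) hθ hs A (B j)
      (hB j hj)).trans ?_
    have := hpp j hj
    gcongr
  rw [sum_const, nsmul_eq_mul] at h4
  have h5 := congrArg (Nat.cast (R := ℝ)) h1
  rw [Nat.cast_add] at h5
  linarith

/-- The mixing property for a weighted set of vertices on one side. -/
lemma Mixing.sum_mul_card_le {r : V → V → Prop} {p M : ℝ} (h : Mixing r p M) (hM : 0 ≤ M)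
    {c : ℝ} (hc : 0 ≤ c) (f : V → ℝ) (A Y : Finset V) (hf : ∀ y ∈ Y, 0 ≤ f y ∧ f y ≤ c) :
    ∑ y ∈ Y, f y * #{x ∈ A | r y x} ≤ p * #A * ∑ y ∈ Y, f y + c * (M * √((#A : ℝ) * #Y)) := by
  -- Only vertices with positive excess matter; raising their weight to `c` leaves an unweighted
  -- count to which mixing applies.
  set X := {y ∈ Y | p * #A < #{x ∈ A | r y x}} with hX
  have h1 : ∑ y ∈ Y, f y * ((#{x ∈ A | r y x} : ℝ) - p * #A) ≤
      ∑ y ∈ X, c * ((#{x ∈ A | r y x} : ℝ) - p * #A) := by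
    rw [hX, sum_filter]
    refine sum_le_sum fun y hy => ?_
    split_ifs with hlt
    · exact mul_le_mul_of_nonneg_right (hf y hy).2 (by linarith)
    · exact mul_nonpos_of_nonneg_of_nonpos (hf y hy).1 (by linarith)
  have h2 : ∑ y ∈ X, c * ((#{x ∈ A | r y x} : ℝ) - p * #A) =
      c * (pairCount r X A - p * (#X * #A)) := by
    rw [← mul_sum, sum_sub_distrib, pairCount_eq_sum_card, sum_const, nsmul_eq_mul]; ring
  have h3 := (abs_le.mp (h X A)).2
  have h4 : √((#X : ℝ) * #A) ≤ √((#A : ℝ) * #Y) := by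
    apply Real.sqrt_le_sqrt
    have : (#X : ℝ) ≤ #Y := by exact_mod_cast card_filter_le _ _
    nlinarith [Nat.cast_nonneg (α := ℝ) #A]
  have h5 : c * (pairCount r X A - p * (#X * #A)) ≤ c * (M * √((#A : ℝ) * #Y)) := by
    apply mul_le_mul_of_nonneg_left _ hc
    exact h3.trans (mul_le_mul_of_nonneg_left h4 hM)
  have h6 : ∑ y ∈ Y, f y * ((#{x ∈ A | r y x} : ℝ) - p * #A) =
      ∑ y ∈ Y, f y * (#{x ∈ A | r y x} : ℝ) - p * #A * ∑ y ∈ Y, f y := by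
    rw [mul_sum, ← sum_sub_distrib]
    exact sum_congr rfl fun y _ => by ring
  linarith

/-- Measuring the error on fixed supersets makes it uniform over the neighbourhoods that are summed
over later. -/
lemma Mixing.pairCount_le {r : V → V → Prop} {p M : ℝ} (h : Mixing r p M) (hM : 0 ≤ M)
    {A B A' B' : Finset V} (hA : A ⊆ A') (hB : B ⊆ B') :
    pairCount r A B ≤ p * (#A * #B) + M * √((#A' : ℝ) * #B') := by
  have h1 := (abs_le.mp (h A B)).2
  have h2 : √((#A : ℝ) * #B) ≤ √((#A' : ℝ) * #B') := by
    apply Real.sqrt_le_sqrt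
    have := card_le_card hA
    have := card_le_card hB
    gcongr
  have := mul_le_mul_of_nonneg_left h2 hM
  linarith

/-- For most `x`, restricting one side to the neighbourhood of `x` keeps the density of `R`. -/
lemma Mixing.sum_pairCount_right_le {r R : V → V → Prop} {p M : ℝ} (h : Mixing r p M)
    (hM : 0 ≤ M) (A Y Z : Finset V) :
    ∑ x ∈ A, pairCount R Y {z ∈ Z | r x z} ≤
      p * #A * pairCount R Y Z + #Y * (M * √((#A : ℝ) * #Z)) := by
  -- Double counting of triples: with `y` fixed, mixing applies between `A` and the
  -- `R`-neighbourhood of `y`, although nothing is known about `R`.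
  have h1 : ∑ x ∈ A, pairCount R Y {z ∈ Z | r x z} = ∑ y ∈ Y, pairCount r A {z ∈ Z | R y z} := by
    unfold pairCount
    rw [sum_comm]
    refine sum_congr rfl fun y _ => sum_congr rfl fun x _ => ?_
    rw [sum_filter, sum_filter]
    refine sum_congr rfl fun z _ => ?_
    split_ifs <;> rfl
  rw [h1]
  calc ∑ y ∈ Y, pairCount r A {z ∈ Z | R y z}
      ≤ ∑ y ∈ Y, (p * (#A * #{z ∈ Z | R y z}) + M * √((#A : ℝ) * #Z)) :=
        sum_le_sum fun y _ => h.pairCount_le hM subset_rfl (filter_subset _ _)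
    _ = _ := by
      rw [sum_add_distrib, sum_const, nsmul_eq_mul, pairCount_eq_sum_card, mul_sum]
      congr 1
      exact sum_congr rfl fun y _ => by ring

/-- For most `x`, restricting both sides to neighbourhoods of `x` keeps the density of `R`. -/
lemma Mixing.sum_pairCount_le {r r' R : V → V → Prop} {p p' M : ℝ} (h : Mixing r p M)
    (h' : Mixing r' p' M) (hr : ∀ x y, r x y → r y x)
    (hM : 0 ≤ M) (hp' : 0 ≤ p') (A Y Z : Finset V) :
    ∑ x ∈ A, pairCount R {y ∈ Y | r x y} {z ∈ Z | r' x z} ≤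
      p * p' * #A * pairCount R Y Z + p' * #Z * (M * √((#A : ℝ) * #Y)) +
        #Y * (M * √((#A : ℝ) * #Z)) := by
  have hr' : ∀ x y, r x y ↔ r y x := fun x y => ⟨hr x y, hr y x⟩
  have h1 : ∑ x ∈ A, pairCount R {y ∈ Y | r x y} {z ∈ Z | r' x z} =
      ∑ y ∈ Y, pairCount r' {x ∈ A | r y x} {z ∈ Z | R y z} := by
    unfold pairCount
    simp_rw [sum_filter]
    rw [sum_comm]
    refine sum_congr rfl fun y _ => sum_congr rfl fun x _ => ?_
    simp only [hr' x y]
    split_ifs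
    · refine sum_congr rfl fun z _ => ?_
      split_ifs <;> rfl
    · rfl
  -- After mixing of `r'` for each fixed `y`, the degrees of `y` into `A` remain, weighted by the
  -- `R`-degree of `y`.
  have h2 := h.sum_mul_card_le hM (c := #Z) (by positivity) (fun y => (#{z ∈ Z | R y z} : ℝ)) A Y
    (fun y _ => ⟨by positivity, by exact_mod_cast card_filter_le _ _⟩)
  rw [h1]
  calc ∑ y ∈ Y, pairCount r' {x ∈ A | r y x} {z ∈ Z | R y z}
      ≤ ∑ y ∈ Y, (p' * (#{x ∈ A | r y x} * #{z ∈ Z | R y z}) + M * √((#A : ℝ) * #Z)) :=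
        sum_le_sum fun y _ => h'.pairCount_le hM (filter_subset _ _) (filter_subset _ _)
    _ = p' * ∑ y ∈ Y, (#{z ∈ Z | R y z} : ℝ) * #{x ∈ A | r y x} +
          #Y * (M * √((#A : ℝ) * #Z)) := by
      rw [sum_add_distrib, sum_const, nsmul_eq_mul, mul_sum]
      congr 1
      exact sum_congr rfl fun y _ => by ring
    _ ≤ p' * (p * #A * ∑ y ∈ Y, (#{z ∈ Z | R y z} : ℝ) + #Z * (M * √((#A : ℝ) * #Y))) +
          #Y * (M * √((#A : ℝ) * #Z)) := by gcongr
    _ = _ := by rw [← pairCount_eq_sum_card]; ring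

end PseudoRandom

/-! ### Greedy embedding, and sparse families forced by its failure. -/

section Embedding
open Finset
open scoped Classical

variable {V : Type*}

/-- Choose `x` for the index `i`, and restrict the later candidate sets accordingly. -/
noncomputable def refineSets {k : ℕ} (rel : Fin k → Fin k → V → V → Prop) (i : Fin k) (x : V)
    (U : Fin k → Finset V) : Fin k → Finset V :=
  fun j => if j < i then U j else if j = i then {x} else {y ∈ U j | rel i j x y}

/-- Greedy embedding with a state predicate `Q`. -/
lemma exists_greedy_embedding {k : ℕ} (rel : Fin k → Fin k → V → V → Prop)
    (ρ : Fin k → Fin k → ℝ) (S : Fin k → Finset V) {m s : ℝ} (hρ : ∀ l j, 0 ≤ ρ l j)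
    (hS : ∀ j, m ≤ #(S j)) (hs0 : 0 < s)
    (hs : ∀ (i : ℕ) (j : Fin k), i ≤ j → s ≤ m * ∏ l with l.val < i, ρ l j)
    (Q : ℕ → (Fin k → Finset V) → Prop) (hQ : Q 0 S)
    (hstep : ∀ (i : Fin k) (U : Fin k → Finset V), (∀ j, U j ⊆ S j) → (∀ j, (U j).Nonempty) →
      (∀ j, i ≤ j → s ≤ #(U j)) → Q i U →
      ∃ x ∈ U i, (∀ j, i < j → ρ i j * #(U j) ≤ #{y ∈ U j | rel i j x y}) ∧
        Q (i + 1) (refineSets rel i x U)) :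
    ∃ f : Fin k → V, (∀ j, f j ∈ S j) ∧ (∀ l j, l < j → rel l j (f l) (f j)) ∧
      Q k (fun j => {f j}) := by
  -- After `i` choices the first `i` sets are singletons, and every later candidate is already
  -- correctly related to all of them.
  have key : ∀ i : ℕ, i ≤ k → ∃ U : Fin k → Finset V, (∀ j, U j ⊆ S j) ∧
      (∀ j, i ≤ j.val → m * ∏ l with l.val < i, ρ l j ≤ #(U j)) ∧
      (∀ j : Fin k, j.val < i → #(U j) = 1) ∧
      (∀ l j : Fin k, l.val < i → l < j → ∀ x ∈ U l, ∀ y ∈ U j, rel l j x y) ∧ Q i U := by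
    intro i
    induction i with
    | zero =>
      intro _
      exact ⟨S, fun _ => subset_rfl, fun j _ => by simpa using hS j, by simp, by simp, hQ⟩
    | succ i ih =>
      intro hi
      obtain ⟨U, hUS, hUm, hU1, hUrel, hUQ⟩ := ih (by omega)
      set i' : Fin k := ⟨i, by omega⟩ with hi'
      have hUs : ∀ j, i' ≤ j → s ≤ #(U j) := fun j hj => (hs i j hj).trans (hUm j hj)
      have hne : ∀ j, (U j).Nonempty := by
        intro j
        rcases lt_or_ge j.val i with hj | hj
        · exact card_pos.mp (by rw [hU1 j hj]; norm_num)
        · have h1 := hs0.trans_le (hUs j hj)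
          exact card_pos.mp (by exact_mod_cast h1)
      obtain ⟨x, hx, hxd, hxQ⟩ := hstep i' U hUS hne hUs hUQ
      have hsub : ∀ j, refineSets rel i' x U j ⊆ U j := by
        intro j
        unfold refineSets
        split_ifs with h1 h2
        · exact subset_rfl
        · rw [h2]; simpa using hx
        · exact filter_subset _ _
      refine ⟨refineSets rel i' x U, fun j => (hsub j).trans (hUS j), ?_, ?_, ?_, hxQ⟩
      · intro j hj
        have h1 : ¬ j < i' := by rw [Fin.lt_def]; simp only [hi']; omega
        have h2 : ¬ j = i' := by rw [Fin.ext_iff]; simp only [hi']; omega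
        have h3 : ({l : Fin k | l.val < i + 1} : Finset (Fin k)) =
            insert i' ({l : Fin k | l.val < i} : Finset (Fin k)) := by
          ext l
          simp only [mem_filter, mem_univ, true_and, mem_insert, Fin.ext_iff, hi']
          omega
        simp only [refineSets, h1, h2, if_false]
        rw [h3, prod_insert (by simp [hi'])]
        refine le_trans ?_ (hxd j (by rw [Fin.lt_def]; simp only [hi']; omega))
        calc m * (ρ i' j * ∏ l with l.val < i, ρ l j)
            = ρ i' j * (m * ∏ l with l.val < i, ρ l j) := by ring
          _ ≤ _ := mul_le_mul_of_nonneg_left (hUm j (by omega)) (hρ _ _)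
      · intro j hj
        unfold refineSets
        split_ifs with h1 h2
        · exact hU1 j h1
        · simp
        · exfalso
          rw [Fin.lt_def] at h1; rw [Fin.ext_iff] at h2
          simp only [hi'] at h1 h2
          omega
      · intro l j hl hlj a ha b hb
        rcases lt_or_ge l.val i with h | h
        · exact hUrel l j h hlj a (hsub l ha) b (hsub j hb)
        · have hli : l = i' := by rw [Fin.ext_iff]; simp only [hi']; omega
          subst hli
          have h1 : ¬ j < i' := by order
          have h2 : ¬ j = i' := by order
          simp only [refineSets, lt_irrefl, if_false, if_true, mem_singleton] at ha
          simp only [refineSets, h1, h2, if_false, mem_filter] at hb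
          rw [ha]; exact hb.2
  obtain ⟨U, hUS, -, hU1, hUrel, hUQ⟩ := key k le_rfl
  have h1 : ∀ j, ∃ a, U j = {a} := fun j => card_eq_one.mp (hU1 j j.isLt)
  choose f hf using h1
  refine ⟨f, fun j => hUS j (by simp [hf]), fun l j hlj => hUrel l j l.isLt hlj _ (by simp [hf]) _
    (by simp [hf]), ?_⟩
  have : U = fun j => {f j} := funext hf
  rwa [← this]

/-- Adjacent vertices of `H` have to be sent to pairs in `R`, non-adjacent ones to pairs in `N`. -/
def edgePattern {k : ℕ} (H : SimpleGraph (Fin k)) (R N : V → V → Prop) (l j : Fin k) :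
    V → V → Prop :=
  if H.Adj l j then R else N

/-- The density of `edgePattern`. -/
noncomputable def patternDensity {k : ℕ} (H : SimpleGraph (Fin k)) (p q : ℝ) (l j : Fin k) : ℝ :=
  if H.Adj l j then p else q

/-- Every vertex has at most `d` earlier neighbours. -/
def HasBackDegreeLE {k : ℕ} (H : SimpleGraph (Fin k)) (d : ℕ) : Prop :=
  ∀ j, #{l | l < j ∧ H.Adj l j} ≤ d

/-- All factors are at most 1, with at most `d` of them equal to `p` and at most `k` equal to `q`.
This bounds the shrinkage of any candidate set. -/
lemma HasBackDegreeLE.le_prod_patternDensity {k d : ℕ} {H : SimpleGraph (Fin k)}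
    (hH : HasBackDegreeLE H d) {p q : ℝ} (hp : 0 < p) (hp1 : p ≤ 1) (hq : 0 < q) (hq1 : q ≤ 1)
    (i : ℕ) (j : Fin k) (hij : i ≤ j) :
    p ^ d * q ^ k ≤ ∏ l with l.val < i, patternDensity H p q l j := by
  unfold patternDensity
  rw [prod_ite, prod_const, prod_const]
  refine mul_le_mul ?_ ?_ (by positivity) (by positivity)
  · refine pow_le_pow_of_le_one hp.le hp1 ((card_le_card ?_).trans (hH j))
    intro l hl
    simp only [mem_filter, mem_univ, true_and] at hl ⊢
    exact ⟨by rw [Fin.lt_def]; omega, hl.2⟩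
  · refine pow_le_pow_of_le_one hq.le hq1 ?_
    exact (card_le_univ _).trans (by simp)

/-- If there is no copy of `H` with edges in `R` and non-edges in `N`, then `R` is sparse between
two large sets. -/
lemma exists_sparse_pair {k d : ℕ} {H : SimpleGraph (Fin k)} (hk : 1 ≤ k)
    (hH : HasBackDegreeLE H d) {R N : V → V → Prop} {q M : ℝ} (hN : Mixing N q M) (hM : 0 ≤ M)
    (hq : 0 < q) (hq1 : q ≤ 1) {ρ θ s : ℝ} (hρ : 0 < ρ) (hρ1 : ρ ≤ 1) (hθ : 0 < θ)
    (hθ2 : θ ≤ 1 / 2) (S : Finset V) (hs0 : 0 < s)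
    (hs : s ≤ #S * (ρ ^ d * (q * (1 - θ)) ^ k))
    (hsM : k * (M ^ 2 / (θ ^ 2 * q ^ 2 * s)) ≤ θ * s)
    (hno : ¬ ∃ f : Fin k → V, ∀ l j, l < j → edgePattern H R N l j (f l) (f j)) :
    ∃ A ⊆ S, ∃ B ⊆ S, s / (2 * k) ≤ #A ∧ s ≤ #B ∧ ∀ x ∈ A, (#{y ∈ B | R x y} : ℝ) ≤ ρ * #B := by
  have hk0 : (0 : ℝ) < k := by exact_mod_cast hk
  by_contra hcon
  push Not at hcon
  apply hno
  have hq' : 0 < q * (1 - θ) := mul_pos hq (by linarith)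
  have hq1' : q * (1 - θ) ≤ 1 := by nlinarith
  suffices h : ∃ f : Fin k → V, (∀ j, f j ∈ S) ∧
      (∀ l j, l < j → edgePattern H R N l j (f l) (f j)) ∧ True from h.imp fun f hf => hf.2.1
  refine exists_greedy_embedding (edgePattern H R N)
    (patternDensity H ρ (q * (1 - θ))) (fun _ => S) (m := #S) (s := s)
    (fun l j => by unfold patternDensity; split_ifs <;> positivity) (fun _ => le_rfl) hs0
    (fun i j hij => hs.trans (mul_le_mul_of_nonneg_left
      (hH.le_prod_patternDensity hρ hρ1 hq' hq1' i j hij) (by positivity)))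
    (fun _ _ => True) trivial ?_
  intro i U hUS _ hUs _
  have hUi := hUs i le_rfl
  obtain ⟨T, hTU, hTc, hT⟩ := exists_typical_subset {j : Fin k | i < j ∧ ¬ H.Adj i j}
    (fun _ => N) (fun _ => q) (p := q) (θ := θ) (s := s) (fun _ _ => hN) hM hq (fun _ _ => le_rfl)
    hθ hs0 (U i) U (fun j hj => hUs j (by simp at hj; exact hj.1.le)) (by
      have h1 : (#{j : Fin k | i < j ∧ ¬ H.Adj i j} : ℝ) ≤ k := by
        exact_mod_cast (card_le_univ _).trans (by simp)
      calc _ ≤ k * (M ^ 2 / (θ ^ 2 * q ^ 2 * s)) := by gcongr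
        _ ≤ θ * s := hsM
        _ ≤ _ := by gcongr)
  have hTs : s / 2 ≤ #T := by nlinarith
  -- `T` takes care of the later non-neighbours. If every `x ∈ T` failed at some later neighbour
  -- `j`, some `j` would have many failures, which together with `U j` form a sparse pair.
  have hgood : ∃ x ∈ T, ∀ j, i < j → H.Adj i j → ρ * #(U j) ≤ #{y ∈ U j | R x y} := by
    by_contra hbad
    push Not at hbad
    have h1 : T ⊆ ({j | i < j} : Finset (Fin k)).biUnion
        fun j => {x ∈ T | (#{y ∈ U j | R x y} : ℝ) < ρ * #(U j)} := by
      intro x hx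
      obtain ⟨j, hj, -, hlt⟩ := hbad x hx
      exact mem_biUnion.mpr ⟨j, by simpa using hj, mem_filter.mpr ⟨hx, hlt⟩⟩
    have h2 : (#T : ℝ) ≤ ∑ j with i < j, (#{x ∈ T | (#{y ∈ U j | R x y} : ℝ) < ρ * #(U j)} : ℝ) := by
      exact_mod_cast (card_le_card h1).trans card_biUnion_le
    have h3 : ∀ j ∈ ({j | i < j} : Finset (Fin k)),
        (#{x ∈ T | (#{y ∈ U j | R x y} : ℝ) < ρ * #(U j)} : ℝ) ≤ s / (2 * k) := by
      intro j hj
      by_contra hlt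
      push Not at hlt
      obtain ⟨x, hx, hx2⟩ := hcon {x ∈ T | (#{y ∈ U j | R x y} : ℝ) < ρ * #(U j)}
        ((filter_subset _ _).trans (hTU.trans (hUS i))) (U j) (hUS j) hlt.le
        (hUs j (by simp at hj; exact hj.le))
      exact absurd (mem_filter.mp hx).2 (not_lt.mpr hx2.le)
    -- Strict because `i` itself is excluded; hence fewer than `s / 2` failures in total, against `s
    -- / 2 ≤ #T`.
    have h4 : ({j | i < j} : Finset (Fin k)).card < k := by
      calc _ < #(univ : Finset (Fin k)) := card_lt_card (by
            rw [Finset.ssubset_univ_iff]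
            intro h
            have := (Finset.ext_iff.mp h i).mpr (mem_univ i)
            simp at this)
        _ = k := by simp
    have h5 := sum_le_sum h3
    rw [sum_const, nsmul_eq_mul] at h5
    have h6 : (#{j : Fin k | i < j} : ℝ) < k := by exact_mod_cast h4
    have h7 : (#{j : Fin k | i < j} : ℝ) * (s / (2 * k)) < k * (s / (2 * k)) :=
      mul_lt_mul_of_pos_right h6 (by positivity)
    have h8 : (k : ℝ) * (s / (2 * k)) = s / 2 := by field_simp
    linarith
  obtain ⟨x, hxT, hx⟩ := hgood
  refine ⟨x, hTU hxT, fun j hij => ?_, trivial⟩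
  unfold patternDensity edgePattern
  split_ifs with h
  · exact hx j hij h
  · exact hT x hxT j (by simp [hij, h])

/-- Iterating `exists_sparse_pair` gives many large sets with `R` sparse between any two. -/
lemma exists_sparse_family {R : V → V → Prop} (hR : ∀ x y, R x y → R y x) {m γ ε : ℝ}
    (hγ : 0 < γ) (hγ1 : γ ≤ 1) (hε : 0 < ε)
    (hpair : ∀ S : Finset V, m ≤ #S → ∃ A ⊆ S, ∃ B ⊆ S, γ * #S ≤ #A ∧ 2 * γ * #S ≤ #B ∧
      ∀ x ∈ A, (#{y ∈ B | R x y} : ℝ) ≤ ε * #B) (h : ℕ) :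
    ∀ S : Finset V, m ≤ #S * γ ^ h → ∃ (ι : Type) (_ : Fintype ι) (W : ι → Finset V),
      Fintype.card ι = 2 ^ h ∧ (∀ i, W i ⊆ S) ∧ (∀ i, #S * γ ^ h ≤ #(W i)) ∧
      ∑ i, ∑ j, (if i = j then 0 else relDensity R (W i) (W j)) ≤ 2 * (2 ^ h) ^ 2 * ε := by
  induction h with
  | zero =>
    intro S _
    refine ⟨Unit, inferInstance, fun _ => S, by simp, fun _ => subset_rfl, by simp, ?_⟩
    simp
    positivity
  | succ h ih =>
    intro S hS
    have hγh : γ ^ (h + 1) ≤ 1 := pow_le_one₀ hγ.le hγ1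
    obtain ⟨A, hAS, B, hBS, hA, hB, hAB⟩ := hpair S (hS.trans (by
      nlinarith [Nat.cast_nonneg (α := ℝ) #S]))
    have hup : ∀ X : Finset V, γ * #S ≤ #X → (#S : ℝ) * γ ^ (h + 1) ≤ #X * γ ^ h := by
      intro X hX
      calc (#S : ℝ) * γ ^ (h + 1) = γ * #S * γ ^ h := by ring
        _ ≤ _ := by gcongr
    obtain ⟨ι, _, W, hι, hWA, hWc, hWd⟩ := ih A (hS.trans (hup A hA))
    set t : ℝ := 2 ^ h with ht
    have ht0 : 0 < t := by positivity
    have hιt : (Fintype.card ι : ℝ) = t := by rw [hι, ht]; norm_cast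
    -- The subsets later found inside `B` are not under control, so sparseness towards the `W i`
    -- must hold at each vertex of `B`. Discarding the vertices where `w` exceeds twice its average
    -- bound ensures this.
    let w : V → ℝ := fun y => ∑ i, (#{x ∈ W i | R y x} : ℝ) / #(W i)
    have hw0 : ∀ y, 0 ≤ w y := fun y => sum_nonneg fun i _ => by positivity
    have hwB : ∑ y ∈ B, w y ≤ t * ε * #B := by
      calc ∑ y ∈ B, w y = ∑ i, pairCount R (W i) B / #(W i) := by
            rw [sum_comm]
            refine sum_congr rfl fun i _ => ?_
            rw [← sum_div, pairCount_comm hR, pairCount_eq_sum_card]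
        _ ≤ ∑ i : ι, ε * #B := by
            refine sum_le_sum fun i _ => ?_
            refine div_le_of_le_mul₀ (by positivity) (by positivity) ?_
            rw [pairCount_eq_sum_card]
            calc _ ≤ ∑ x ∈ W i, ε * #B := sum_le_sum fun x hx => hAB x (hWA i hx)
              _ = _ := by rw [sum_const, nsmul_eq_mul]; ring
        _ = _ := by rw [sum_const, nsmul_eq_mul, card_univ, hιt]; ring
    set B' := {y ∈ B | w y ≤ 2 * t * ε} with hB'
    -- By Markov's inequality at least half of `B` survives, which is why `B` was required to have
    -- size `2 * γ * #S`.
    have hB'c : γ * #S ≤ #B' := by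
      have h1 := card_filter_add_card_filter_not (s := B) (fun y => w y ≤ 2 * t * ε)
      have h2 : (#{y ∈ B | ¬ w y ≤ 2 * t * ε} : ℝ) * (2 * t * ε) ≤ ∑ y ∈ B, w y := by
        calc _ = ∑ y ∈ B with ¬ w y ≤ 2 * t * ε, 2 * t * ε := by rw [sum_const, nsmul_eq_mul]
          _ ≤ ∑ y ∈ B with ¬ w y ≤ 2 * t * ε, w y :=
            sum_le_sum fun y hy => (not_le.mp (mem_filter.mp hy).2).le
          _ ≤ _ := sum_le_sum_of_subset_of_nonneg (filter_subset _ _) fun y _ _ => hw0 y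
      have h3 : (#{y ∈ B | ¬ w y ≤ 2 * t * ε} : ℝ) * 2 ≤ #B := by
        have : 0 < t * ε := by positivity
        nlinarith
      have h5 := congrArg (Nat.cast (R := ℝ)) h1
      rw [Nat.cast_add] at h5
      linarith
    obtain ⟨ι', _, W', hι', hWB', hWc', hWd'⟩ := ih B' (hS.trans (hup B' hB'c))
    have hιt' : (Fintype.card ι' : ℝ) = t := by rw [hι', ht]; norm_cast
    have hcross : ∑ j, ∑ i, relDensity R (W' j) (W i) ≤ 2 * t ^ 2 * ε := by
      calc ∑ j, ∑ i, relDensity R (W' j) (W i) = ∑ j, (∑ y ∈ W' j, w y) / #(W' j) := by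
            refine sum_congr rfl fun j _ => ?_
            rw [sum_comm, sum_div]
            refine sum_congr rfl fun i _ => ?_
            unfold relDensity
            rw [pairCount_eq_sum_card, ← sum_div, div_div, mul_comm (#(W i) : ℝ)]
        _ ≤ ∑ j : ι', 2 * t * ε := by
            refine sum_le_sum fun j _ => ?_
            refine div_le_of_le_mul₀ (by positivity) (by positivity) ?_
            calc _ ≤ ∑ y ∈ W' j, 2 * t * ε :=
                  sum_le_sum fun y hy => (mem_filter.mp (hWB' j hy)).2
              _ = _ := by rw [sum_const, nsmul_eq_mul]; ring
        _ = _ := by rw [sum_const, nsmul_eq_mul, card_univ, hιt']; ring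
    have hcross' : ∑ i, ∑ j, relDensity R (W i) (W' j) ≤ 2 * t ^ 2 * ε := by
      rw [sum_comm]
      simpa only [relDensity_comm hR] using hcross
    refine ⟨ι ⊕ ι', inferInstance, Sum.elim W W', ?_, ?_, ?_, ?_⟩
    · rw [Fintype.card_sum, hι, hι']; ring
    · rintro (i | i)
      · exact (hWA i).trans hAS
      · exact (hWB' i).trans ((filter_subset _ _).trans hBS)
    · rintro (i | i)
      · exact (hup A hA).trans (hWc i)
      · exact (hup B' hB'c).trans (hWc' i)
    · simp only [Fintype.sum_sum_type, Sum.elim_inl, Sum.elim_inr, Sum.inl.injEq, Sum.inr.injEq,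
        reduceCtorEq, if_false, sum_add_distrib]
      -- Four blocks, two inner and two cross, each contribute at most `2 t² ε`.
      have : (2 : ℝ) * (2 ^ (h + 1)) ^ 2 * ε = 8 * t ^ 2 * ε := by rw [ht]; ring
      rw [this]
      linarith

end Embedding

/-! ### A potential function that keeps an embedding out of `R`. -/

section Potential
open Finset
open scoped Classical

variable {V : Type*}

/-- Turns the mixing error on sets of size at least `s` into a relative error `M / s`. -/
lemma sqrt_mul_le_div {s a b : ℝ} (hs : 0 < s) (ha : s ≤ a) (hb : s ≤ b) :
    √(a * b) ≤ a * b / s := by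
  have h1 : s ≤ √(a * b) := by
    apply Real.le_sqrt_of_sq_le
    rw [sq]
    exact mul_le_mul ha hb hs.le (hs.le.trans ha)
  rw [le_div_iff₀ hs]
  have h2 := Real.mul_self_sqrt (mul_nonneg (hs.le.trans ha) (hs.le.trans hb))
  nlinarith [Real.sqrt_nonneg (a * b)]

/-- The contribution of the pair `j, l` to the potential: the density of `R`, normalised by the
density `p` of the ambient relation as long as `j` has not been embedded. -/
noncomputable def pairWeight {k : ℕ} (p : ℝ) (R : V → V → Prop) (i : ℕ) (U : Fin k → Finset V)
    (j l : Fin k) : ℝ :=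
  (if i ≤ j.val then 1 / p else 1) * relDensity R (U j) (U l)

lemma pairWeight_nonneg {k : ℕ} {p : ℝ} (hp : 0 < p) (R : V → V → Prop) (i : ℕ)
    (U : Fin k → Finset V) (j l : Fin k) : 0 ≤ pairWeight p R i U j l :=
  mul_nonneg (by split_ifs <;> positivity) (relDensity_nonneg _ _ _)

lemma relDensity_singleton_left (R : V → V → Prop) (x : V) (B : Finset V) :
    relDensity R {x} B = (#{y ∈ B | R x y} : ℝ) / #B := by
  simp [relDensity, pairCount_eq_sum_card]

lemma relDensity_singleton_right {R : V → V → Prop} (A : Finset V) (x : V) :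
    relDensity R A {x} = pairCount R A {x} / #A := by
  simp [relDensity]

lemma sum_pairCount_singleton (R : V → V → Prop) (A B : Finset V) :
    ∑ x ∈ B, pairCount R A {x} = pairCount R A B := by
  simp only [pairCount, sum_singleton]
  exact sum_comm

/-- Gives a denominator independent of the chosen vertex, so that the numerators can be summed over
all choices. -/
lemma relDensity_filter_le {R : V → V → Prop} {Y Z : Finset V} {c : ℝ} (hc : 0 < c)
    {Y' Z' : Finset V} (h : c * (#Y * #Z) ≤ #Y' * #Z') (hYZ : 0 < (#Y : ℝ) * #Z) :
    relDensity R Y' Z' ≤ pairCount R Y' Z' / (c * (#Y * #Z)) :=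
  div_le_div_of_nonneg_left (pairCount_nonneg _ _ _) (by positivity) h

/-- Averaging over typical choices of `x`, one greedy step hardly increases the weight of a pair. -/
lemma sum_pairWeight_refineSets_le {k : ℕ} {rel : Fin k → Fin k → V → V → Prop}
    {pp : Fin k → Fin k → ℝ} {p M θ s : ℝ} {R : V → V → Prop}
    (hmix : ∀ i j, Mixing (rel i j) (pp i j) M) (hsymm : ∀ i j x y, rel i j x y → rel i j y x)
    (hM : 0 ≤ M) (hp : 0 < p) (hp1 : p ≤ 1) (hpp : ∀ i j, p / 3 ≤ pp i j) (hθ : 0 < θ)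
    (hθ1 : θ < 1) (hs : 0 < s) (i : Fin k) (U : Fin k → Finset V) (hU : ∀ j, (U j).Nonempty)
    (hUs : ∀ j, i ≤ j → s ≤ #(U j)) {T : Finset V} (hT : T ⊆ U i)
    (hTd : ∀ x ∈ T, ∀ j, i < j → pp i j * (1 - θ) * #(U j) ≤ #{y ∈ U j | rel i j x y})
    {j l : Fin k} (hjl : j < l) (hpj : pp j l = p) :
    ∑ x ∈ T, pairWeight p R (i + 1) (refineSets rel i x U) j l ≤
      #(U i) * (pairWeight p R i U j l + 18 * M / (p ^ 3 * s)) / (1 - θ) ^ 2 := by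
  have hκ : 0 < 1 - θ := by linarith
  have hcard : ∀ j, (0 : ℝ) < #(U j) := fun j => by exact_mod_cast card_pos.mpr (hU j)
  have hpp0 : ∀ i j, 0 < pp i j := fun i j => lt_of_lt_of_le (by positivity) (hpp i j)
  have herr : 0 ≤ 18 * M / (p ^ 3 * s) := by positivity
  have hw := pairWeight_nonneg hp R i U j l
  have hA := hcard i
  have hTA : (#T : ℝ) ≤ #(U i) := by exact_mod_cast card_le_card hT
  have hpinv : ∀ i j, (pp i j)⁻¹ ≤ 3 / p := fun i j => by
    rw [← inv_div]; exact inv_anti₀ (by positivity) (hpp i j)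
  have hMs : 0 ≤ M / s := by positivity
  have hp2 : p ^ 2 ≤ 1 := pow_le_one₀ hp.le hp1
  -- it is enough to bound the sum up to a factor `(1 - θ)⁻¹` and the error term
  have weaken : ∀ c : ℝ, 0 ≤ c → c ≤ pairWeight p R i U j l + 18 * M / (p ^ 3 * s) →
      #(U i) * c / (1 - θ) ≤
        #(U i) * (pairWeight p R i U j l + 18 * M / (p ^ 3 * s)) / (1 - θ) ^ 2 := by
    intro c hc0 hc
    apply div_le_div₀ (by positivity) (by gcongr) (by positivity)
    nlinarith
  have weaken' : ∀ c : ℝ, 0 ≤ c → c ≤ pairWeight p R i U j l →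
      #(U i) * c ≤ #(U i) * (pairWeight p R i U j l + 18 * M / (p ^ 3 * s)) / (1 - θ) ^ 2 := by
    intro c hc0 hc
    refine le_trans ?_ (weaken c hc0 (by linarith))
    exact le_div_self (by positivity) hκ (by linarith)
  -- If `l < i` the pair is unchanged; if `l = i`, averaging over `U l` reproduces its density.
  -- Otherwise `U l` shrinks, and the position of `j` decides.
  rcases lt_trichotomy l i with hli | hli | hli
  · have hji : j < i := hjl.trans hli
    have h1 : ¬ (i : ℕ) + 1 ≤ j := by rw [Fin.lt_def] at hji; omega
    have h2 : ¬ (i : ℕ) ≤ j := by omega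
    simp only [pairWeight, refineSets, hli, hji, h1, if_true, if_false, one_mul, sum_const,
      nsmul_eq_mul]
    refine le_trans ?_ (weaken' _ (relDensity_nonneg R (U j) (U l)) (by simp [pairWeight, h2]))
    exact mul_le_mul_of_nonneg_right hTA (relDensity_nonneg _ _ _)
  · subst hli
    have h1 : ¬ (l : ℕ) + 1 ≤ j := by rw [Fin.lt_def] at hjl; omega
    have h2 : ¬ (l : ℕ) ≤ j := by omega
    simp only [pairWeight, refineSets, hjl, h1, if_true, if_false, one_mul, lt_irrefl]
    refine le_trans ?_ (weaken' _ (relDensity_nonneg R (U j) (U l)) (by simp [pairWeight, h2]))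
    calc ∑ x ∈ T, relDensity R (U j) {x} ≤ ∑ x ∈ U l, relDensity R (U j) {x} :=
          sum_le_sum_of_subset_of_nonneg hT fun _ _ _ => relDensity_nonneg _ _ _
      _ = pairCount R (U j) (U l) / #(U j) := by
          simp only [relDensity_singleton_right]
          rw [← sum_div, sum_pairCount_singleton]
      _ = _ := by
          have := hcard j
          unfold relDensity; field_simp
  · have hl1 : ¬ l < i := by order
    have hl2 : ¬ l = i := by order
    have hl := hcard l
    rcases lt_trichotomy j i with hji | hji | hji
    · have h1 : ¬ (i : ℕ) + 1 ≤ j := by rw [Fin.lt_def] at hji; omega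
      have h2 : ¬ (i : ℕ) ≤ j := by omega
      have hj := hcard j
      have hP := hpp0 i l
      simp only [pairWeight, refineSets, hji, h1, hl1, hl2, if_true, if_false, one_mul]
      refine le_trans ?_ (weaken (relDensity R (U j) (U l) + M / s * (pp i l)⁻¹) ?_ ?_)
      · calc ∑ x ∈ T, relDensity R (U j) {y ∈ U l | rel i l x y}
            ≤ ∑ x ∈ T, pairCount R (U j) {y ∈ U l | rel i l x y} /
                (pp i l * (1 - θ) * (#(U j) * #(U l))) := by
              refine sum_le_sum fun x hx => relDensity_filter_le (by positivity) ?_ (by positivity)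
              calc pp i l * (1 - θ) * (#(U j) * #(U l))
                  = #(U j) * (pp i l * (1 - θ) * #(U l)) := by ring
                _ ≤ _ := mul_le_mul_of_nonneg_left (hTd x hx l hli) hj.le
          _ ≤ ∑ x ∈ U i, pairCount R (U j) {y ∈ U l | rel i l x y} /
                (pp i l * (1 - θ) * (#(U j) * #(U l))) :=
              sum_le_sum_of_subset_of_nonneg hT fun _ _ _ =>
                div_nonneg (pairCount_nonneg _ _ _) (by positivity)
          _ ≤ (pp i l * #(U i) * pairCount R (U j) (U l) +
                #(U j) * (M * (#(U i) * #(U l) / s))) /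
                (pp i l * (1 - θ) * (#(U j) * #(U l))) := by
              rw [← sum_div]
              gcongr
              refine ((hmix i l).sum_pairCount_right_le hM _ _ _).trans ?_
              gcongr
              exact sqrt_mul_le_div hs (hUs i le_rfl) (hUs l hli.le)
          _ = _ := by unfold relDensity; field_simp
      · have := relDensity_nonneg R (U j) (U l)
        positivity
      · simp only [pairWeight, h2, if_false, one_mul]
        have h3 : M / s * (pp i l)⁻¹ ≤ M / s * (3 / p) := by gcongr; exact hpinv i l
        have h4 : M / s * (3 / p) = 3 * M * p ^ 2 / (p ^ 3 * s) := by field_simp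
        have h5 : 3 * M * p ^ 2 / (p ^ 3 * s) ≤ 18 * M / (p ^ 3 * s) := by
          refine div_le_div_of_nonneg_right ?_ (by positivity)
          nlinarith [mul_nonneg hM (sub_nonneg.mpr hp2)]
        linarith
    -- Here the factor `1 / p` is spent: `U l` may shrink to a fraction `p (1 - θ)` while all
    -- `R`-neighbours of `x` survive.
    · subst hji
      have h1 : ¬ (j : ℕ) + 1 ≤ j := by omega
      simp only [pairWeight, refineSets, h1, hl1, hl2, lt_irrefl, if_true, if_false, one_mul]
      refine le_trans ?_ (weaken (1 / p * relDensity R (U j) (U l)) ?_ ?_)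
      · calc ∑ x ∈ T, relDensity R {x} {y ∈ U l | rel j l x y}
            ≤ ∑ x ∈ T, (#{y ∈ U l | R x y} : ℝ) / (p * (1 - θ) * #(U l)) := by
              refine sum_le_sum fun x hx => ?_
              rw [relDensity_singleton_left]
              apply div_le_div₀ (by positivity) ?_ (by positivity) ?_
              · exact_mod_cast card_le_card (by
                  rw [filter_filter]
                  exact monotone_filter_right _ fun y _ hy => hy.2)
              · rw [← hpj]; exact hTd x hx l hli
          _ ≤ ∑ x ∈ U j, (#{y ∈ U l | R x y} : ℝ) / (p * (1 - θ) * #(U l)) :=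
              sum_le_sum_of_subset_of_nonneg hT fun _ _ _ => by positivity
          _ = _ := by
              rw [← sum_div, ← pairCount_eq_sum_card]
              unfold relDensity; field_simp
      · have := relDensity_nonneg R (U j) (U l)
        positivity
      · simp only [pairWeight, le_refl, if_true]
        linarith
    · have h1 : (i : ℕ) + 1 ≤ j := by rw [Fin.lt_def] at hji; omega
      have h2 : (i : ℕ) ≤ j := by omega
      have hj1 : ¬ j < i := by order
      have hj2 : ¬ j = i := by order
      have hj := hcard j
      have hP := hpp0 i l
      have hP' := hpp0 i j
      simp only [pairWeight, refineSets, h1, h2, hj1, hj2, hl1, hl2, if_true, if_false]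
      rw [← mul_sum]
      have h3 : ∑ x ∈ T, relDensity R {y ∈ U j | rel i j x y} {y ∈ U l | rel i l x y} ≤
          #(U i) * (relDensity R (U j) (U l) +
            M / s * ((pp i j)⁻¹ + (pp i j)⁻¹ * (pp i l)⁻¹)) / (1 - θ) ^ 2 := by
        calc ∑ x ∈ T, relDensity R {y ∈ U j | rel i j x y} {y ∈ U l | rel i l x y}
            ≤ ∑ x ∈ T, pairCount R {y ∈ U j | rel i j x y} {y ∈ U l | rel i l x y} /
                (pp i j * pp i l * (1 - θ) ^ 2 * (#(U j) * #(U l))) := by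
              refine sum_le_sum fun x hx => relDensity_filter_le (by positivity) ?_ (by positivity)
              calc pp i j * pp i l * (1 - θ) ^ 2 * (#(U j) * #(U l))
                  = (pp i j * (1 - θ) * #(U j)) * (pp i l * (1 - θ) * #(U l)) := by ring
                _ ≤ _ := mul_le_mul (hTd x hx j hji) (hTd x hx l hli) (by positivity)
                  (by positivity)
          _ ≤ ∑ x ∈ U i, pairCount R {y ∈ U j | rel i j x y} {y ∈ U l | rel i l x y} /
                (pp i j * pp i l * (1 - θ) ^ 2 * (#(U j) * #(U l))) :=
              sum_le_sum_of_subset_of_nonneg hT fun _ _ _ =>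
                div_nonneg (pairCount_nonneg _ _ _) (by positivity)
          _ ≤ (pp i j * pp i l * #(U i) * pairCount R (U j) (U l) +
                pp i l * #(U l) * (M * (#(U i) * #(U j) / s)) +
                #(U j) * (M * (#(U i) * #(U l) / s))) /
                (pp i j * pp i l * (1 - θ) ^ 2 * (#(U j) * #(U l))) := by
              rw [← sum_div]
              gcongr
              refine ((hmix i j).sum_pairCount_le (hmix i l) (hsymm i j) hM hP.le _ _ _).trans ?_
              gcongr
              · exact sqrt_mul_le_div hs (hUs i le_rfl) (hUs j hji.le)
              · exact sqrt_mul_le_div hs (hUs i le_rfl) (hUs l hli.le)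
          _ = _ := by unfold relDensity; field_simp; ring
      have h4 : M / s * ((pp i j)⁻¹ + (pp i j)⁻¹ * (pp i l)⁻¹) ≤
          M / s * (3 / p + 3 / p * (3 / p)) := by
        have := (hpinv i j)
        have := (hpinv i l)
        gcongr
      have h5 : 1 / p * (M / s * (3 / p + 3 / p * (3 / p))) =
          (3 * M * p + 9 * M) / (p ^ 3 * s) := by field_simp; ring
      have h6 : (3 * M * p + 9 * M) / (p ^ 3 * s) ≤ 18 * M / (p ^ 3 * s) := by
        gcongr; nlinarith
      calc _ ≤ 1 / p * (#(U i) * (relDensity R (U j) (U l) +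
            M / s * ((pp i j)⁻¹ + (pp i j)⁻¹ * (pp i l)⁻¹)) / (1 - θ) ^ 2) := by gcongr
        _ = #(U i) * (1 / p * relDensity R (U j) (U l) +
            1 / p * (M / s * ((pp i j)⁻¹ + (pp i j)⁻¹ * (pp i l)⁻¹))) / (1 - θ) ^ 2 := by ring
        _ ≤ _ := by
          have h7 : 1 / p * (M / s * ((pp i j)⁻¹ + (pp i j)⁻¹ * (pp i l)⁻¹)) ≤
              18 * M / (p ^ 3 * s) := by
            refine le_trans ?_ (h5.le.trans h6)
            gcongr
          gcongr

/-- The total weight of the edges of `H`, an upper bound for the expected number of edges of `H`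
sent to pairs in `R`. -/
noncomputable def potential {k : ℕ} (H : SimpleGraph (Fin k)) (p : ℝ) (R : V → V → Prop) (i : ℕ)
    (U : Fin k → Finset V) : ℝ :=
  ∑ j, ∑ l, if j < l ∧ H.Adj j l then pairWeight p R i U j l else 0

lemma potential_nonneg {k : ℕ} (H : SimpleGraph (Fin k)) {p : ℝ} (hp : 0 < p) (R : V → V → Prop)
    (i : ℕ) (U : Fin k → Finset V) : 0 ≤ potential H p R i U :=
  sum_nonneg fun _ _ => sum_nonneg fun _ _ => by
    split_ifs
    · exact pairWeight_nonneg hp _ _ _ _ _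
    · exact le_rfl

/-- At stage `k` no normalisation is left, so a single edge in `R` already contributes 1 to a sum of
nonnegative terms. -/
lemma not_rel_of_potential_lt_one {k : ℕ} {H : SimpleGraph (Fin k)} {p : ℝ} (hp : 0 < p)
    {R : V → V → Prop} {f : Fin k → V} (h : potential H p R k (fun j => {f j}) < 1) {j l : Fin k}
    (hjl : j < l) (hadj : H.Adj j l) : ¬ R (f j) (f l) := by
  intro hR
  have h0 : ∀ j l, 0 ≤ if j < l ∧ H.Adj j l then pairWeight p R k (fun j => {f j}) j l else 0 := by
    intro j l
    split_ifs
    · exact pairWeight_nonneg hp _ _ _ _ _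
    · exact le_rfl
  have h1 := single_le_sum (f := fun j => ∑ l, if j < l ∧ H.Adj j l then
    pairWeight p R k (fun j => {f j}) j l else 0) (fun j _ => sum_nonneg fun l _ => h0 j l)
    (mem_univ j)
  have h2 := single_le_sum (f := fun l => if j < l ∧ H.Adj j l then
    pairWeight p R k (fun j => {f j}) j l else 0) (fun l _ => h0 j l) (mem_univ l)
  have h3 : pairWeight p R k (fun j => {f j}) j l = 1 := by
    simp [pairWeight, relDensity, pairCount, filter_singleton, hR, not_le.mpr j.isLt]
  simp only [hjl, hadj, and_self, if_true, h3] at h2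
  unfold potential at h
  linarith

/-- If `R` is sparse between the sets `S j`, then there is a copy of `H` with edges in `T \ R`
and non-edges in `N`. -/
lemma exists_embedding_avoiding {k d : ℕ} {H : SimpleGraph (Fin k)} (hH : HasBackDegreeLE H d)
    {T N R : V → V → Prop} {p q M θ s m : ℝ} (hT : Mixing T p M) (hN : Mixing N q M)
    (hTs : ∀ x y, T x y → T y x) (hNs : ∀ x y, N x y → N y x)
    (hM : 0 ≤ M) (hp : 0 < p) (hp1 : p ≤ 1) (hpq : p / 3 ≤ q) (hq1 : q ≤ 1) (hθ : 0 < θ)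
    (hθ1 : θ < 1) (hθk : 1 / 2 ≤ (1 - θ) ^ (3 * k)) (S : Fin k → Finset V)
    (hS : ∀ j, m ≤ #(S j)) (hm : 0 ≤ m) (hs0 : 0 < s)
    (hs : s ≤ m * ((p * (1 - θ)) ^ d * (q * (1 - θ)) ^ k))
    (hsM : k * (M ^ 2 / (θ ^ 2 * (p / 3) ^ 2 * s)) ≤ θ * s)
    (herr : k ^ 3 * (18 * M / (p ^ 3 * s)) < 1 / 4) (hpot : potential H p R 0 S ≤ 1 / 4) :
    ∃ f : Fin k → V, (∀ l j, l < j → edgePattern H T N l j (f l) (f j)) ∧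
      ∀ l j, l < j → H.Adj l j → ¬ R (f l) (f j) := by
  have hκ : 0 < 1 - θ := by linarith
  have hκ1 : 1 - θ ≤ 1 := by linarith
  have hq : 0 < q := lt_of_lt_of_le (by positivity) hpq
  set e := (k : ℝ) ^ 2 * (18 * M / (p ^ 3 * s)) with he
  have he0 : 0 ≤ e := by positivity
  obtain ⟨f, -, hf, hfQ⟩ := exists_greedy_embedding (edgePattern H T N)
    (patternDensity H (p * (1 - θ)) (q * (1 - θ))) S (m := m) (s := s)
    (fun l j => by unfold patternDensity; split_ifs <;> positivity) hS hs0
    (fun i j hij => hs.trans (mul_le_mul_of_nonneg_left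
      (hH.le_prod_patternDensity (by positivity) (by nlinarith) (by positivity) (by nlinarith)
        i j hij) hm))
    -- Each step adds `e` and divides by `(1 - θ) ^ 3`. At `i = k` the numerator is below 1/2 by
    -- `herr` and the denominator is at least 1/2 by `hθk`.
    (fun i U => potential H p R i U ≤ (1 / 4 + i * e) / (1 - θ) ^ (3 * i)) (by simpa using hpot) (by
      intro i U _ hU hUs hUQ
      have hmix : ∀ i j, Mixing (edgePattern H T N i j) (patternDensity H p q i j) M := by
        intro i j; unfold edgePattern patternDensity; split_ifs <;> assumption
      have hsymm : ∀ i j x y, edgePattern H T N i j x y → edgePattern H T N i j y x := by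
        intro i j; unfold edgePattern; split_ifs <;> assumption
      have hpp : ∀ i j, p / 3 ≤ patternDensity H p q i j := by
        intro i j; unfold patternDensity; split_ifs <;> linarith
      obtain ⟨X, hXU, hXc, hX⟩ := exists_typical_subset ({j | i < j} : Finset (Fin k))
        (fun j => edgePattern H T N i j) (fun j => patternDensity H p q i j) (p := p / 3) (θ := θ)
        (s := s) (fun j _ => hmix i j) hM (by positivity) (fun j _ => hpp i j) hθ hs0 (U i) U
        (fun j hj => hUs j (by simp at hj; exact hj.le)) (by
          have h1 : (#{j : Fin k | i < j} : ℝ) ≤ k := by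
            exact_mod_cast (card_le_univ _).trans (by simp)
          calc _ ≤ k * (M ^ 2 / (θ ^ 2 * (p / 3) ^ 2 * s)) := by gcongr
            _ ≤ θ * s := hsM
            _ ≤ _ := by have := hUs i le_rfl; gcongr)
      have hUi : (0 : ℝ) < #(U i) := by exact_mod_cast card_pos.mpr (hU i)
      have hX0 : X.Nonempty := by
        rw [← card_pos]
        have : (0 : ℝ) < #X := lt_of_lt_of_le (by positivity) hXc
        exact_mod_cast this
      have hXd : ∀ x ∈ X, ∀ j, i < j → patternDensity H p q i j * (1 - θ) * #(U j) ≤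
          #{y ∈ U j | edgePattern H T N i j x y} := fun x hx j hij => hX x hx j (by simpa using hij)
      have hsum : ∑ x ∈ X, potential H p R (i + 1) (refineSets (edgePattern H T N) i x U) ≤
          #(U i) * (potential H p R i U + e) / (1 - θ) ^ 2 := by
        unfold potential
        rw [sum_comm]
        calc _ = ∑ j, ∑ l, ∑ x ∈ X, (if j < l ∧ H.Adj j l then pairWeight p R (i + 1)
                (refineSets (edgePattern H T N) i x U) j l else 0) :=
              sum_congr rfl fun j _ => sum_comm
          _ ≤ ∑ j : Fin k, ∑ l : Fin k, #(U i) * ((if j < l ∧ H.Adj j l then pairWeight p R i U j l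
                else 0) + 18 * M / (p ^ 3 * s)) / (1 - θ) ^ 2 := by
              refine sum_le_sum fun j _ => sum_le_sum fun l _ => ?_
              split_ifs with h
              · exact sum_pairWeight_refineSets_le hmix hsymm hM hp hp1 hpp hθ hθ1 hs0 i U hU hUs
                  hXU hXd h.1 (by simp [patternDensity, h.2])
              · rw [sum_const_zero]; positivity
          _ = _ := by
              simp only [← sum_div, ← mul_sum, sum_add_distrib, sum_const, card_univ,
                Fintype.card_fin, nsmul_eq_mul]
              rw [he]; ring
      -- Two factors `1 - θ` come from the shrinking sets; the third comes from averaging over `X`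
      -- instead of `U i`.
      obtain ⟨x, hxX, hx⟩ := exists_le_of_sum_le hX0
        (f := fun x => potential H p R (i + 1) (refineSets (edgePattern H T N) i x U))
        (g := fun _ => (potential H p R i U + e) / (1 - θ) ^ 3) (by
          have hpot0 := potential_nonneg H hp R i U
          refine hsum.trans ?_
          rw [sum_const, nsmul_eq_mul]
          calc #(U i) * (potential H p R i U + e) / (1 - θ) ^ 2
              = (1 - θ) * #(U i) * ((potential H p R i U + e) / (1 - θ) ^ 3) := by field_simp
            _ ≤ _ := by gcongr)
      refine ⟨x, hXU hxX, fun j hij => ?_, ?_⟩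
      · refine le_trans (le_of_eq ?_) (hXd x hxX j hij)
        unfold patternDensity
        split_ifs <;> rfl
      · refine hx.trans ?_
        have h1 : (1 - θ) ^ (3 * i.val) ≤ 1 := pow_le_one₀ hκ.le hκ1
        have h2 : e ≤ e / (1 - θ) ^ (3 * i.val) := le_div_self he0 (by positivity) h1
        calc (potential H p R i U + e) / (1 - θ) ^ 3
            ≤ ((1 / 4 + i * e) / (1 - θ) ^ (3 * i.val) + e / (1 - θ) ^ (3 * i.val)) /
                (1 - θ) ^ 3 := by gcongr
          _ = _ := by
            rw [show 3 * (i.val + 1) = 3 * i.val + 3 by ring, pow_add]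
            push_cast
            field_simp
            ring)
  refine ⟨f, hf, fun l j hlj hadj => not_rel_of_potential_lt_one hp (hfQ.trans_lt ?_) hlj hadj⟩
  rw [div_lt_one (by positivity)]
  have : (k : ℝ) * e = k ^ 3 * (18 * M / (p ^ 3 * s)) := by rw [he]; ring
  linarith

end Potential

/-! ### Degenerate orderings, and graphs as mixing relations. -/

section Graph
open Finset
open scoped Classical

/-- A degenerate graph has a vertex ordering with few backward neighbours. -/
lemma IsDegenerate.exists_ordering {W : Type*} [Fintype W] {H : SimpleGraph W} {d : ℕ}
    (hH : IsDegenerate H d) (n : ℕ) : ∀ S : Finset W, #S = n → ∃ f : Fin n → W,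
      Function.Injective f ∧ (∀ j, f j ∈ S) ∧ ∀ j, #{l | l < j ∧ H.Adj (f l) (f j)} ≤ d := by
  induction n with
  | zero => exact fun S _ => ⟨Fin.elim0, fun i => i.elim0, fun i => i.elim0, fun i => i.elim0⟩
  | succ n ih =>
    intro S hS
    have hne : S.Nonempty := card_pos.mp (by omega)
    -- A vertex of small degree in the subgraph induced on `S` goes last.
    obtain ⟨v, hv, hvd⟩ := hH ((⊤ : H.Subgraph).induce ↑S) (by simpa using hne)
    have hvS : v ∈ S := by simpa using hv
    have hvd' : #{w ∈ S | H.Adj v w} ≤ d := by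
      have h1 : ((⊤ : H.Subgraph).induce ↑S).neighborSet v = ↑{w ∈ S | H.Adj v w} := by
        ext w
        simp [SimpleGraph.Subgraph.mem_neighborSet, hvS]
      rw [h1, Set.encard_coe_eq_coe_finsetCard] at hvd
      exact_mod_cast hvd
    obtain ⟨f, hf, hfS, hfd⟩ := ih (S.erase v) (by rw [card_erase_of_mem hvS]; omega)
    have hinj : Function.Injective (Fin.snoc (α := fun _ => W) f v) :=
      Fin.snoc_injective_iff.mpr ⟨hf, by
        rintro ⟨i, hi⟩
        exact (mem_erase.mp (hfS i)).1 hi⟩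
    have hmem : ∀ j, Fin.snoc (α := fun _ => W) f v j ∈ S := by
      intro j
      refine Fin.lastCases ?_ (fun i => ?_) j
      · simpa using hvS
      · simpa using (mem_erase.mp (hfS i)).2
    refine ⟨Fin.snoc (α := fun _ => W) f v, hinj, hmem, fun j => ?_⟩
    refine Fin.lastCases ?_ (fun i => ?_) j
    · refine le_trans (card_le_card_of_injOn _ (fun l hl => ?_) hinj.injOn) hvd'
      simp only [coe_filter, mem_univ, true_and, Set.mem_ofPred_eq, Fin.snoc_last] at hl
      exact mem_coe.mpr (mem_filter.mpr ⟨hmem l, hl.2.symm⟩)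
    · refine le_trans (le_trans (card_le_card ?_) (card_image_le (f := Fin.castSucc))) (hfd i)
      intro l hl
      obtain ⟨-, hl1, hl2⟩ := mem_filter.mp hl
      revert hl1 hl2
      refine Fin.lastCases ?_ (fun l' => ?_) l
      · intro h
        exact absurd h (not_lt.mpr (Fin.le_last _))
      · intro h1 h2
        simp only [Fin.snoc_castSucc] at h2
        exact mem_image.mpr ⟨l', mem_filter.mpr ⟨mem_univ _, by simpa using h1, h2⟩, rfl⟩

lemma IsDegenerate.exists_hasBackDegreeLE {k d : ℕ} {H : SimpleGraph (Fin k)}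
    (hH : IsDegenerate H d) : ∃ σ : Fin k ≃ Fin k, HasBackDegreeLE (H.comap σ) d := by
  obtain ⟨f, hf, -, hfd⟩ := hH.exists_ordering k univ (by simp)
  refine ⟨Equiv.ofBijective f (Finite.injective_iff_bijective.mp hf), fun j => ?_⟩
  simpa using hfd j

variable {V : Type*} {G : SimpleGraph V}

lemma Mixing.mono {r : V → V → Prop} {p M M' : ℝ} (h : Mixing r p M) (hM : M ≤ M') :
    Mixing r p M' := fun A B =>
  (h A B).trans (mul_le_mul_of_nonneg_right hM (Real.sqrt_nonneg _))

lemma IsPseudoRandom.mixing_adj [DecidableRel G.Adj] {p lam : ℝ} (h : IsPseudoRandom G p lam) :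
    Mixing G.Adj p lam := by
  intro A B
  rcases A.eq_empty_or_nonempty with rfl | hA
  · simp [pairCount]
  rcases B.eq_empty_or_nonempty with rfl | hB
  · simp [pairCount]
  have hA0 : (0 : ℝ) < #A := by exact_mod_cast card_pos.mpr hA
  have hB0 : (0 : ℝ) < #B := by exact_mod_cast card_pos.mpr hB
  have h1 : pairCount G.Adj A B = (G.edgeDensity A B : ℝ) * (#A * #B) := by
    rw [SimpleGraph.edgeDensity_def, SimpleGraph.interedges_def]
    push_cast
    rw [div_mul_cancel₀ _ (by positivity), pairCount, ← sum_product', natCast_card_filter]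
    refine sum_congr rfl fun x _ => ?_
    congr
  have h2 := h A B hA hB
  have hs : 0 < √((#A : ℝ) * #B) := Real.sqrt_pos.mpr (by positivity)
  rw [le_div_iff₀ hs] at h2
  have h3 := Real.mul_self_sqrt (show (0 : ℝ) ≤ (#A : ℝ) * #B by positivity)
  rw [h1, ← sub_mul, abs_mul, abs_of_nonneg (show (0 : ℝ) ≤ (#A : ℝ) * #B by positivity)]
  calc |(G.edgeDensity A B : ℝ) - p| * (#A * #B)
      = |(G.edgeDensity A B : ℝ) - p| * √((#A : ℝ) * #B) * √((#A : ℝ) * #B) := by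
        rw [mul_assoc, h3]
    _ ≤ _ := mul_le_mul_of_nonneg_right h2 hs.le

/-- A single vertex spans no loop, so the error there is `p`. This makes `lam` positive and lets
`lam / p` absorb the `+ 1` in `Mixing.nonAdj`. -/
lemma Mixing.le_of_adj {p lam : ℝ} (h : Mixing G.Adj p lam) (v : V) : p ≤ lam := by
  have := h {v} {v}
  simp [pairCount, filter_singleton] at this
  exact (le_abs_self p).trans this

/-- Distinct non-adjacent vertices of `G`. -/
def nonAdj (G : SimpleGraph V) (x y : V) : Prop := ¬ G.Adj x y ∧ x ≠ y

lemma nonAdj_symm (x y : V) (h : nonAdj G x y) : nonAdj G y x :=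
  ⟨fun h' => h.1 h'.symm, h.2.symm⟩

/-- The complement of adjacency also contains the diagonal, which has `#(A ∩ B) ≤ √(#A * #B)` pairs;
removing it costs the `+ 1`. -/
lemma Mixing.nonAdj {p lam : ℝ} (h : Mixing G.Adj p lam) :
    Mixing (nonAdj G) (1 - p) (lam + 1) := by
  intro A B
  have h1 : pairCount G.Adj A B + pairCount (_root_.nonAdj G) A B + #(A ∩ B) = #A * #B := by
    have h2 : (#(A ∩ B) : ℝ) = ∑ x ∈ A, ∑ y ∈ B, if x = y then (1 : ℝ) else 0 := by
      simp [← filter_mem_eq_inter]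
    have h3 : (#A : ℝ) * #B = ∑ x ∈ A, ∑ y ∈ B, (1 : ℝ) := by simp
    rw [h2, h3]
    unfold pairCount
    simp only [← sum_add_distrib]
    refine sum_congr rfl fun x _ => sum_congr rfl fun y _ => ?_
    by_cases hxy : x = y
    · subst hxy; simp [_root_.nonAdj]
    · by_cases hadj : G.Adj x y <;> simp [_root_.nonAdj, hxy, hadj]
  have h4 : (#(A ∩ B) : ℝ) ≤ √((#A : ℝ) * #B) := by
    apply Real.le_sqrt_of_sq_le
    rw [sq]
    have h5 : (#(A ∩ B) : ℝ) ≤ #A := by exact_mod_cast card_le_card inter_subset_left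
    have h6 : (#(A ∩ B) : ℝ) ≤ #B := by exact_mod_cast card_le_card inter_subset_right
    gcongr
  have h7 := abs_le.mp (h A B)
  have h8 : (0 : ℝ) ≤ #(A ∩ B) := by positivity
  rw [abs_le]
  constructor <;> nlinarith [h7.1, h7.2]

/-- The pairs joined by an edge of colour `c`. -/
def colourRel {K : Type*} (C : G.EdgeLabeling K) (c : K) (x y : V) : Prop :=
  ∃ h : G.Adj x y, C.get x y h = c

lemma colourRel_symm {K : Type*} (C : G.EdgeLabeling K) (c : K) (x y : V)
    (h : colourRel C c x y) : colourRel C c y x := by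
  obtain ⟨h, hc⟩ := h
  exact ⟨h.symm, by rw [C.get_comm]; exact hc⟩

/-- Both relations are symmetric and force distinct endpoints, so pairs `l < j` suffice and
injectivity is automatic. -/
lemma hasInducedMonoCopy_of_edgePattern {K : Type*} {C : G.EdgeLabeling K} {c : K} {k : ℕ}
    {H : SimpleGraph (Fin k)} (σ : Fin k ≃ Fin k) (f : Fin k → V)
    (hf : ∀ l j, l < j → edgePattern (H.comap σ) (colourRel C c) (nonAdj G) l j (f l) (f j)) :
    HasInducedMonoCopy C c H := by
  have key : ∀ l j, l ≠ j → f l ≠ f j ∧ (H.Adj (σ l) (σ j) ↔ G.Adj (f l) (f j)) ∧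
      (H.Adj (σ l) (σ j) → colourRel C c (f l) (f j)) := by
    have key' : ∀ l j, l < j → f l ≠ f j ∧ (H.Adj (σ l) (σ j) ↔ G.Adj (f l) (f j)) ∧
        (H.Adj (σ l) (σ j) → colourRel C c (f l) (f j)) := by
      intro l j hlj
      have h1 := hf l j hlj
      unfold edgePattern at h1
      rw [SimpleGraph.comap_adj] at h1
      split_ifs at h1 with h2
      · obtain ⟨h3, hc⟩ := h1
        exact ⟨h3.ne, iff_of_true h2 h3, fun _ => ⟨h3, hc⟩⟩
      · exact ⟨h1.2, iff_of_false h2 h1.1, fun h => absurd h h2⟩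
    intro l j hlj
    rcases lt_or_gt_of_ne hlj with h | h
    · exact key' l j h
    · obtain ⟨h1, h2, h3⟩ := key' j l h
      exact ⟨h1.symm, by rw [H.adj_comm, h2, G.adj_comm],
        fun h4 => colourRel_symm _ _ _ _ (h3 h4.symm)⟩
  have hinj : Function.Injective (f ∘ σ.symm) := by
    refine Function.Injective.comp (fun l j h => ?_) σ.symm.injective
    by_contra hlj
    exact (key l j hlj).1 h
  refine ⟨⟨⟨f ∘ σ.symm, hinj⟩, ?_⟩, ?_⟩
  · intro a b
    by_cases hab : a = b
    · subst hab; simp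
    · have := (key (σ.symm a) (σ.symm b) (by simpa using hab)).2.1
      simpa using this.symm
  · intro a b hab
    obtain ⟨_, h⟩ := (key (σ.symm a) (σ.symm b) (by simpa using hab.ne)).2.2 (by simpa using hab)
    exact h

end Graph

/-! ### Numerical estimates behind the bound on `lam`. -/

section Numerics
open Finset

/-- Bernoulli's inequality gives `(1/4) ^ (4p/3) ≤ 1 - p`, an equality at `p = 0` and `p = 3/4`; the
exponent `8p/3` of 2 is then relaxed to `3p`. -/
lemma two_rpow_neg_le_one_sub {p : ℝ} (hp : 0 ≤ p) (hp' : p ≤ 3 / 4) :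
    (2 : ℝ) ^ (-(3 * p)) ≤ 1 - p := by
  have h1 := rpow_one_add_le_one_add_mul_self (s := -(3 / 4)) (by norm_num)
    (p := 4 / 3 * p) (by positivity) (by linarith)
  have h2 : (1 + -(3 / 4) : ℝ) = (2 : ℝ) ^ (-2 : ℝ) := by
    rw [Real.rpow_neg (by norm_num)]; norm_num
  rw [h2, ← Real.rpow_mul (by norm_num)] at h1
  calc (2 : ℝ) ^ (-(3 * p)) ≤ (2 : ℝ) ^ (-2 * (4 / 3 * p)) :=
        Real.rpow_le_rpow_of_exponent_le (by norm_num) (by linarith)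
    _ ≤ _ := by linarith

lemma one_sub_inv_pow_ge {k : ℕ} (hk : 1 ≤ k) (a : ℕ) :
    1 - a / 6 ≤ (1 - 1 / (6 * (k : ℝ))) ^ (a * k) := by
  have hk0 : (1 : ℝ) ≤ k := by exact_mod_cast hk
  have h0 : 1 / (6 * (k : ℝ)) ≤ 1 := by
    rw [div_le_one (by positivity)]; linarith
  have h1 := one_add_mul_le_pow (a := -(1 / (6 * (k : ℝ)))) (by linarith) (a * k)
  rw [← sub_eq_add_neg] at h1
  refine le_trans (le_of_eq ?_) h1
  push_cast
  field_simp
  ring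

/-- A graph on `k` vertices needs at most `k` colours; the minimum keeps the number of sets below `2
* k`. In the exponent, each halving level costs 5, the final embedding 5 and the error terms 4. -/
lemma clog_bounds {χ k : ℕ} (hχ : 2 ≤ χ) (hk : 1 ≤ k) :
    2 ^ Nat.clog 2 (min χ k) ≤ 2 * k ∧
      (5 * Nat.clog 2 (min χ k) + 9 : ℝ) ≤ 20 * Real.logb 2 χ := by
  have hχ0 : (2 : ℝ) ≤ χ := by exact_mod_cast hχ
  have hlog1 : 1 ≤ Real.logb 2 χ := by
    rw [Real.le_logb_iff_rpow_le (by norm_num) (by positivity)]; simpa using hχ0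
  rcases le_or_gt (min χ k) 1 with h | h
  · rw [Nat.clog_of_right_le_one h]
    exact ⟨by omega, by push_cast; linarith⟩
  · have h1 := Nat.pow_pred_clog_lt_self (b := 2) (by norm_num) h
    have h2 := Nat.clog_pos (b := 2) (by norm_num) h
    set c := Nat.clog 2 (min χ k)
    obtain ⟨e, he⟩ : ∃ e, c = e + 1 := ⟨c - 1, by omega⟩
    rw [he] at h1 ⊢
    simp only [Nat.pred_succ] at h1
    refine ⟨by rw [pow_succ]; have := min_le_right χ k; omega, ?_⟩
    have h3 : (e : ℝ) ≤ Real.logb 2 χ := by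
      rw [Real.le_logb_iff_rpow_le (by norm_num) (by positivity), Real.rpow_natCast]
      exact_mod_cast h1.le.trans (min_le_left _ _)
    push_cast
    rcases Nat.eq_zero_or_pos e with h0 | h0
    · rw [h0]; push_cast; linarith
    · have : (1 : ℝ) ≤ e := by exact_mod_cast h0
      linarith

/-- The relative size of the candidate sets in the greedy embedding. -/
noncomputable def shrinkFactor (k d : ℕ) (p : ℝ) : ℝ :=
  (p / (32 * (k : ℝ) ^ 4)) ^ d * ((1 - p) * (1 - 1 / (6 * (k : ℝ)))) ^ k

/-- With `a`, `b` the two bases: `a ^ 4` pays for `p / (32 k⁴)` and `b ^ 3` for `1 - p`. The spare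
`a ^ d ≤ 1 / (10 k)` pays for `4 k` and the loss 5/6. -/
lemma pow_five_le_shrinkFactor {k d : ℕ} (hk : 1 ≤ k) (hd : 1 ≤ d) {p : ℝ} (hp : 0 < p)
    (hp' : p ≤ 3 / 4) :
    ((p / (10 * (k : ℝ))) ^ d * (2 : ℝ) ^ (-(p * (k : ℝ)))) ^ 5 ≤ shrinkFactor k d p / (4 * k) := by
  have hk0 : (1 : ℝ) ≤ k := by exact_mod_cast hk
  set a := p / (10 * (k : ℝ)) with ha
  set b := (2 : ℝ) ^ (-(p * (k : ℝ))) with hb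
  have ha0 : 0 < a := by positivity
  have ha1 : a ≤ 1 / (10 * k) := by rw [ha]; gcongr; linarith
  have ha2 : a ≤ 1 := ha1.trans (by rw [div_le_one (by positivity)]; linarith)
  have hb0 : 0 < b := by positivity
  have hb1 : b ≤ 1 := Real.rpow_le_one_of_one_le_of_nonpos (by norm_num) (by
    have : 0 ≤ p * k := by positivity
    linarith)
  have h1 : a ^ 4 ≤ p / (32 * (k : ℝ) ^ 4) := by
    rw [ha, div_pow, mul_pow, div_le_div_iff₀ (by positivity) (by positivity)]
    have : p ^ 4 ≤ p := by
      calc p ^ 4 ≤ p ^ 1 := pow_le_pow_of_le_one hp.le (by linarith) (by norm_num)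
        _ = p := pow_one p
    calc p ^ 4 * (32 * (k : ℝ) ^ 4) ≤ p * (10 ^ 4 * k ^ 4) := by
          gcongr; norm_num
      _ = _ := by ring
  have h2 : b ^ 3 ≤ (1 - p) ^ k := by
    calc b ^ 3 = ((2 : ℝ) ^ (-(3 * p))) ^ k := by
          rw [hb, ← Real.rpow_natCast, ← Real.rpow_natCast, ← Real.rpow_mul (by norm_num),
            ← Real.rpow_mul (by norm_num)]
          congr 1; push_cast; ring
      _ ≤ _ := by gcongr; exact two_rpow_neg_le_one_sub hp.le hp'
  have h3 := one_sub_inv_pow_ge hk 1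
  rw [one_mul] at h3
  have h4 : a ^ d ≤ 1 / (10 * k) := (pow_le_of_le_one ha0.le ha2 (by omega)).trans ha1
  rw [le_div_iff₀ (by positivity)]
  unfold shrinkFactor
  have h5 : (a ^ d) ^ 4 * (b ^ 3 * (5 / 6)) ≤ (p / (32 * (k : ℝ) ^ 4)) ^ d *
      ((1 - p) * (1 - 1 / (6 * (k : ℝ)))) ^ k := by
    rw [mul_pow (1 - p), ← pow_mul, mul_comm d, pow_mul]
    have h7 : (5 / 6 : ℝ) ≤ (1 - 1 / (6 * (k : ℝ))) ^ k := by norm_num at h3 ⊢; linarith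
    have h8 : 0 ≤ 1 - p := by linarith
    gcongr
  refine le_trans ?_ h5
  calc (a ^ d * b) ^ 5 * (4 * k) = (a ^ d) ^ 4 * (b ^ 3 * (b ^ 2 * (a ^ d * (4 * k)))) := by ring
    _ ≤ (a ^ d) ^ 4 * (b ^ 3 * (1 ^ 2 * (1 / (10 * k) * (4 * k)))) := by gcongr
    _ ≤ _ := by
      gcongr
      field_simp
      norm_num

/-- The bound on `lam` makes all error terms negligible on the smallest candidate sets. -/
lemma error_le_of_le {χ d k : ℕ} (hχ : 2 ≤ χ) (hd : 1 ≤ d) (hk : 1 ≤ k) {p lam n : ℝ}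
    (hp : 0 < p) (hp' : p ≤ 3 / 4) (hn : 0 ≤ n)
    (hlam : lam ≤ ((p / (10 * (k : ℝ))) ^ d * (2 : ℝ) ^ (-(p * (k : ℝ)))) ^
      (20 * Real.logb 2 (χ : ℝ)) * n) :
    100 * k ^ 3 * (2 * lam / p) / p ^ 3 ≤
      n * (shrinkFactor k d p / (4 * k)) ^ Nat.clog 2 (min χ k) * shrinkFactor k d p := by
  have hk0 : (1 : ℝ) ≤ k := by exact_mod_cast hk
  have h5 := pow_five_le_shrinkFactor hk hd hp hp'
  obtain ⟨-, hexp⟩ := clog_bounds hχ hk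
  set h := Nat.clog 2 (min χ k)
  set q := (p / (10 * (k : ℝ))) ^ d * (2 : ℝ) ^ (-(p * (k : ℝ))) with hq
  have hq0 : 0 < q := by positivity
  have hqa : q ≤ p / (10 * k) := by
    have h1 : p / (10 * (k : ℝ)) ≤ 1 := by rw [div_le_one (by positivity)]; linarith
    have h2 : (2 : ℝ) ^ (-(p * (k : ℝ))) ≤ 1 :=
      Real.rpow_le_one_of_one_le_of_nonpos (by norm_num) (by
        have : 0 ≤ p * k := by positivity
        linarith)
    calc q ≤ (p / (10 * (k : ℝ))) * 1 := by
          apply mul_le_mul (pow_le_of_le_one (by positivity) h1 (by omega)) h2 <;> positivity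
      _ = _ := mul_one _
  have hq1 : q ≤ 1 := hqa.trans (by rw [div_le_one (by positivity)]; linarith)
  have hr : shrinkFactor k d p / (4 * k) ≤ shrinkFactor k d p := by
    refine div_le_self ?_ (by linarith)
    have : 0 < shrinkFactor k d p / (4 * k) := lt_of_lt_of_le (by positivity) h5
    by_contra hneg
    push Not at hneg
    exact absurd this (not_lt.mpr (div_nonpos_of_nonpos_of_nonneg hneg.le (by positivity)))
  have h6 : lam ≤ q ^ (5 * h + 9) * n := by
    refine hlam.trans (mul_le_mul_of_nonneg_right ?_ hn)
    rw [← Real.rpow_natCast]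
    exact Real.rpow_le_rpow_of_exponent_ge hq0 hq1 (by push_cast; exact hexp)
  have h7 : 200 * (k : ℝ) ^ 3 / p ^ 4 * q ^ 4 ≤ 1 := by
    calc 200 * (k : ℝ) ^ 3 / p ^ 4 * q ^ 4 ≤ 200 * (k : ℝ) ^ 3 / p ^ 4 * (p / (10 * k)) ^ 4 := by
          gcongr
      _ = 1 / (50 * (k : ℝ)) := by field_simp; norm_num
      _ ≤ 1 := by rw [div_le_one (by positivity)]; linarith
  calc 100 * k ^ 3 * (2 * lam / p) / p ^ 3 = 200 * (k : ℝ) ^ 3 / p ^ 4 * lam := by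
        field_simp; ring
    _ ≤ 200 * (k : ℝ) ^ 3 / p ^ 4 * (q ^ (5 * h + 9) * n) := by gcongr
    _ = (200 * (k : ℝ) ^ 3 / p ^ 4 * q ^ 4) * (n * (q ^ 5) ^ h * q ^ 5) := by ring
    _ ≤ 1 * (n * (q ^ 5) ^ h * q ^ 5) := by gcongr
    _ ≤ _ := by
      rw [one_mul]
      have h8 : 0 ≤ shrinkFactor k d p / (4 * k) := le_trans (by positivity) h5
      gcongr
      exact h5.trans hr

end Numerics

/-! ### Choice of parameters and conclusion. -/

section Main
open Finset
open scoped Classical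

lemma typical_error_le {k : ℕ} (hk : 1 ≤ k) {p M s : ℝ} (hp : 0 < p) (hp1 : p ≤ 1) (hM : 0 ≤ M)
    (hs : 0 < s) (h : 100 * k ^ 3 * M / p ^ 3 ≤ s) :
    k * (M ^ 2 / ((1 / (6 * (k : ℝ))) ^ 2 * (p / 3) ^ 2 * s)) ≤ 1 / (6 * (k : ℝ)) * s := by
  have hk0 : (1 : ℝ) ≤ k := by exact_mod_cast hk
  have h1 : 100 * k ^ 2 * M / p ≤ s := by
    refine le_trans ?_ h
    rw [div_le_div_iff₀ hp (by positivity)]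
    have : p ^ 3 ≤ p := by
      calc p ^ 3 ≤ p ^ 1 := pow_le_pow_of_le_one hp.le hp1 (by norm_num)
        _ = p := pow_one p
    gcongr
    norm_num
  have h2 : (100 * k ^ 2 * M / p) ^ 2 ≤ s ^ 2 := pow_le_pow_left₀ (by positivity) h1 2
  have h3 : k * (M ^ 2 / ((1 / (6 * (k : ℝ))) ^ 2 * (p / 3) ^ 2 * s)) =
      1944 / 10000 * (100 * k ^ 2 * M / p) ^ 2 / (6 * k * s) := by
    field_simp; ring
  have h4 : 1 / (6 * (k : ℝ)) * s = s / (6 * k) := by ring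
  rw [h3, h4, div_le_div_iff₀ (by positivity) (by positivity)]
  calc 1944 / 10000 * (100 * k ^ 2 * M / p) ^ 2 * (6 * (k : ℝ))
      ≤ 1 * s ^ 2 * (6 * (k : ℝ)) := by gcongr; norm_num
    _ = s * (6 * k * s) := by ring

/-- Adjacent vertices lie in different sets `W i`, and each density is at most the whole sum `D`. -/
lemma potential_zero_le {V ι : Type*} [Fintype ι] {k : ℕ} (H : SimpleGraph (Fin k)) {p D : ℝ}
    (hp : 0 < p) (hD : 0 ≤ D) {R : V → V → Prop} (W : ι → Finset V)
    (hW : ∑ i, ∑ j, (if i = j then 0 else relDensity R (W i) (W j)) ≤ D) (g : H.Coloring ι) :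
    potential H p R 0 (fun j => W (g j)) ≤ k ^ 2 * (D / p) := by
  have h0 : ∀ i j, 0 ≤ if i = j then 0 else relDensity R (W i) (W j) := by
    intro i j
    split_ifs
    · exact le_rfl
    · exact relDensity_nonneg _ _ _
  have h1 : ∀ i j, i ≠ j → relDensity R (W i) (W j) ≤ D := by
    intro i j hij
    have h2 := single_le_sum (f := fun i => ∑ j, if i = j then 0 else relDensity R (W i) (W j))
      (fun i _ => sum_nonneg fun j _ => h0 i j) (mem_univ i)
    have h3 := single_le_sum (f := fun j => if i = j then 0 else relDensity R (W i) (W j))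
      (fun j _ => h0 i j) (mem_univ j)
    simp only [hij, if_false] at h3
    linarith
  calc potential H p R 0 (fun j => W (g j)) ≤ ∑ _j : Fin k, ∑ _l : Fin k, D / p := by
        refine sum_le_sum fun j _ => sum_le_sum fun l _ => ?_
        split_ifs with h
        · simp only [pairWeight, Nat.zero_le, if_true]
          rw [one_div, inv_mul_eq_div]
          exact div_le_div_of_nonneg_right (h1 _ _ (g.valid h.2)) hp.le
        · positivity
    _ = _ := by
      simp only [sum_const, card_univ, Fintype.card_fin, nsmul_eq_mul]
      ring

lemma exists_copy_of_no_copy {V : Type*} [Fintype V] [Nonempty V] {G : SimpleGraph V}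
    [DecidableRel G.Adj] {χ d k : ℕ} (hχ : 2 ≤ χ) (hd : 1 ≤ d) (hk : 1 ≤ k)
    {p lam : ℝ} (hp : 0 < p) (hp' : p ≤ 3 / 4) (hG : IsPseudoRandom G p lam)
    (hlam : lam ≤ ((p / (10 * (k : ℝ))) ^ d * (2 : ℝ) ^ (-(p * (k : ℝ)))) ^
      (20 * Real.logb 2 (χ : ℝ)) * (Fintype.card V : ℝ))
    {R : V → V → Prop} (hR : ∀ x y, R x y → R y x)
    {H₀ H₁ : SimpleGraph (Fin k)} (hH₀ : HasBackDegreeLE H₀ d) (hH₁ : HasBackDegreeLE H₁ d)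
    (hcol : H₁.Colorable χ)
    (hno : ¬ ∃ f : Fin k → V, ∀ l j, l < j → edgePattern H₀ R (nonAdj G) l j (f l) (f j)) :
    ∃ f : Fin k → V, (∀ l j, l < j → edgePattern H₁ G.Adj (nonAdj G) l j (f l) (f j)) ∧
      ∀ l j, l < j → H₁.Adj l j → ¬ R (f l) (f j) := by
  have hk0 : (1 : ℝ) ≤ k := by exact_mod_cast hk
  have hmix := hG.mixing_adj
  have hpl : p ≤ lam := hmix.le_of_adj (Classical.arbitrary V)
  -- Since `1 ≤ lam / p` and `lam ≤ lam / p`, this covers both `lam` and `lam + 1`.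
  set M := 2 * lam / p with hMdef
  have hlam0 : 0 < lam := hp.trans_le hpl
  have hM0 : 0 < M := by positivity
  have hlM : lam ≤ lam / p := le_div_self hlam0.le hp (by linarith)
  have hlM' : 1 ≤ lam / p := by rwa [le_div_iff₀ hp, one_mul]
  have hM2 : M = lam / p + lam / p := by rw [hMdef]; ring
  have hT : Mixing G.Adj p M := hmix.mono (by linarith)
  have hN : Mixing (nonAdj G) (1 - p) M := hmix.nonAdj.mono (by linarith)
  set θ := 1 / (6 * (k : ℝ)) with hθdef
  have hθ : 0 < θ := by positivity
  have hθ1 : θ ≤ 1 / 6 := by rw [hθdef]; gcongr; linarith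
  have hq : 0 < 1 - p := by linarith
  -- Chosen so that the initial potential bound `k² * 2 (2k)² ρ / p` is exactly 1/4.
  set ρ := p / (32 * (k : ℝ) ^ 4) with hρdef
  have hρ : 0 < ρ := by positivity
  have hρp : ρ ≤ p / 32 := by
    rw [hρdef]; gcongr
    have : 1 ≤ (k : ℝ) ^ 4 := one_le_pow₀ hk0
    linarith
  have herr := error_le_of_le hχ hd hk hp hp' (Nat.cast_nonneg _) hlam
  obtain ⟨htk, -⟩ := clog_bounds hχ hk
  set h := Nat.clog 2 (min χ k) with hh
  set r := shrinkFactor k d p with hr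
  have hrdef : r = ρ ^ d * ((1 - p) * (1 - θ)) ^ k := rfl
  have hq' : 0 < (1 - p) * (1 - θ) := mul_pos hq (by linarith)
  have hr0 : 0 < r := by rw [hrdef]; positivity
  have hr1 : r ≤ 1 := by
    rw [hrdef]
    exact mul_le_one₀ (pow_le_one₀ hρ.le (by linarith)) (by positivity)
      (pow_le_one₀ hq'.le (by nlinarith))
  have hE : 0 < 100 * k ^ 3 * M / p ^ 3 := by positivity
  have hpair : ∀ S : Finset V, 100 * k ^ 3 * M / p ^ 3 / r ≤ #S → ∃ A ⊆ S, ∃ B ⊆ S,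
      r / (4 * k) * #S ≤ #A ∧ 2 * (r / (4 * k)) * #S ≤ #B ∧
        ∀ x ∈ A, (#{y ∈ B | R x y} : ℝ) ≤ ρ * #B := by
    intro S hS
    rw [div_le_iff₀ hr0] at hS
    have hs0 : 0 < #S * r := hE.trans_le hS
    have hsM := typical_error_le hk hp (by linarith) hM0.le hs0 hS
    obtain ⟨A, hAS, B, hBS, hA, hB, hAB⟩ := exists_sparse_pair hk hH₀ hN hM0.le hq (by linarith) hρ
      (by linarith) hθ (by linarith) S hs0 le_rfl (le_trans (by
        -- Equivalent to `p ≤ 3 / 4`: non-adjacency is at most three times sparser than adjacency.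
        have : p / 3 ≤ 1 - p := by linarith
        gcongr) hsM) hno
    have e1 : 2 * (r / (4 * k)) * #S = #S * r / (2 * k) := by field_simp; norm_num
    refine ⟨A, hAS, B, hBS, ?_, ?_, hAB⟩
    · have : 0 ≤ r / (4 * k) * #S := by positivity
      linarith
    · rw [e1]
      exact (div_le_self hs0.le (by linarith)).trans hB
  obtain ⟨ι, _, W, hι, -, hWc, hWd⟩ := exists_sparse_family hR (γ := r / (4 * k)) (by positivity)
    (by rw [div_le_one (by positivity)]; linarith) hρ hpair h univ (by
      rw [div_le_iff₀ hr0, card_univ]; exact herr)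
  rw [card_univ] at hWc
  have hcol' : H₁.Colorable (min χ k) := by
    rcases min_choice χ k with h' | h' <;> rw [h']
    · exact hcol
    · simpa using H₁.colorable_of_fintype
  have g : H₁.Coloring ι := hcol'.toColoring (by
    rw [hι]; exact Nat.le_pow_clog (by norm_num) _)
  set s := Fintype.card V * (r / (4 * k)) ^ h * r with hsdef
  have hs0 : 0 < s := hE.trans_le herr
  refine exists_embedding_avoiding hH₁ (θ := θ) (m := Fintype.card V * (r / (4 * k)) ^ h)
    (s := s) hT hN (fun _ _ h => h.symm) nonAdj_symm hM0.le hp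
    (by linarith) (by linarith) (by linarith) hθ (by linarith) ?_ (fun j => W (g j))
    (fun j => hWc (g j)) (by positivity) hs0 ?_ (typical_error_le hk hp (by linarith) hM0.le hs0 herr)
    ?_ ?_
  · have := one_sub_inv_pow_ge hk 3
    norm_num at this ⊢
    simpa [hθdef] using this
  · rw [hsdef, hrdef]
    -- Edges of `G` are denser than the threshold `ρ`, so the shrink factor of the first embedding
    -- also serves the second.
    have : ρ ≤ p * (1 - θ) := by nlinarith
    gcongr
  · have h1 : (k : ℝ) ^ 3 * (18 * M / (p ^ 3 * s)) = 18 / 100 * (100 * k ^ 3 * M / p ^ 3) / s := by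
      field_simp
    rw [h1, div_lt_iff₀ hs0]
    linarith
  · refine (potential_zero_le H₁ hp (by positivity) W hWd g).trans ?_
    have h1 : (2 : ℝ) ^ h ≤ 2 * k := by exact_mod_cast htk
    calc (k : ℝ) ^ 2 * (2 * (2 ^ h) ^ 2 * ρ / p) ≤ (k : ℝ) ^ 2 * (2 * (2 * k) ^ 2 * ρ / p) := by
          gcongr
      _ = 1 / 4 := by rw [hρdef]; field_simp; norm_num

end Main

theorem theorem4p5 (χ d k : ℕ) (hχ : 2 ≤ χ) (hd : 1 ≤ d) (hk : 1 ≤ k)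
    {V : Type*} [Fintype V] [Nonempty V] (G : SimpleGraph V) [DecidableRel G.Adj]
    (p lam : ℝ) (hp : 0 < p) (hp' : p ≤ 3 / 4)
    (hG : IsPseudoRandom G p lam)
    (hlam : lam ≤ ((p / (10 * (k : ℝ))) ^ d * (2 : ℝ) ^ (-(p * (k : ℝ)))) ^
      (20 * Real.logb 2 (χ : ℝ)) * (Fintype.card V : ℝ))
    (C : G.EdgeLabeling (Fin 2)) :
    ∃ c : Fin 2, ∀ H : SimpleGraph (Fin k),
      IsDegenerate H d → H.chromaticNumber ≤ (χ : ℕ∞) → HasInducedMonoCopy C c H := by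
  by_contra! hcon
  -- The two missed graphs may differ; this is what yields one colour for all `H` at once.
  obtain ⟨H₀, hH₀, -, hno₀⟩ := hcon 0
  obtain ⟨H₁, hH₁, hχ₁, hno₁⟩ := hcon 1
  obtain ⟨σ₀, hσ₀⟩ := hH₀.exists_hasBackDegreeLE
  obtain ⟨σ₁, hσ₁⟩ := hH₁.exists_hasBackDegreeLE
  rw [SimpleGraph.chromaticNumber_le_iff_colorable] at hχ₁
  obtain ⟨f, hf, hfR⟩ := exists_copy_of_no_copy hχ hd hk hp hp' hG hlam (colourRel_symm C 0) hσ₀ hσ₁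
    ⟨hχ₁.some.comp (SimpleGraph.Hom.comap σ₁ H₁)⟩
    (fun ⟨f, hf⟩ => hno₀ (hasInducedMonoCopy_of_edgePattern σ₀ f hf))
  refine hno₁ (hasInducedMonoCopy_of_edgePattern σ₁ f fun l j hlj => ?_)
  have h1 := hf l j hlj
  unfold edgePattern at h1 ⊢
  split_ifs at h1 ⊢ with hadj
  · refine ⟨h1, ?_⟩
    have h2 : C.get (f l) (f j) h1 ≠ 0 := fun h => hfR l j hlj hadj ⟨h1, h⟩
    omega
  · exact h1
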